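/- Let $\mu_{\rm Airy}(a)=\frac1\pi\sqrt a\,\mathbf 1_{\{a>0\}}$. A \emph{candidate density} is an (a.e.) nonnegative function $\mu$ on $\mathbb R$ such that $\mu-\mu_{\rm Airy}$ is integrable with $\int_{\mathbb R}(\mu(a)-\mu_{\rm Airy}(a))\,da=0$ and such that the double integral $$J_{\rm Airy}(\mu)=-\int_{\mathbb R^2}\log|a_1-a_2|\,\prod_{i=1}^2\big(\mu(a_i)-\mu_{\rm Airy}(a_i)\big)\,da_1\,da_2$$ converges absolutely. Put $U(\mu)=\frac43\int_{-\infty}^0|a|^{3/2}\mu(a)\,da\in[0,\infty]$ and $I_{\rm Airy}=J_{\rm Airy}+U$. For $A,a_0\ge 0$ define, with values in $(-\infty,\infty]$, $$\Sigma_J(\mu)=A\int_{\mathbb R}(a_0-a)_+\,\mu(a)\,da+J_{\rm Airy}(\mu),\qquad \Sigma(\mu)=\Sigma_J(\mu)+U(\mu)=A\int_{\mathbb R}(a_0-a)_+\,\mu(a)\,da+I_{\rm Airy}(\mu).$$ Let $$\Phi_-(z)=\frac{4}{15\pi^6}(1-\pi^2z)^{5/2}-\frac{4}{15\pi^6}+\frac{2}{3\pi^4}z-\frac{1}{2\pi^2}z^2\qquad(z\le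 0),$$ $$u_0=\frac{2A^2}{\pi^2}\Big(\sqrt{1+\frac{\pi^2a_0}{A^2}}-1\Big),\qquad v_0=a_0-u_0,$$ $$\mu_*(a)=\Big(\frac1\pi\sqrt{a-u_0}+\frac{A}{2\pi^2}\log\Big|\frac{\sqrt{a-u_0}+\sqrt{v_0}}{\sqrt{a-u_0}-\sqrt{v_0}}\Big|\Big)\mathbf 1_{\{a>u_0\}}$$ (for $A=0$, expressions involving $A$ in a denominator are read as their limits as $A\downarrow0$, so that $u_0=0$ and $A^6\Phi_-(-a_0/A^2)=0$). Then: 1. $\mu_*$ vanishes on $(-\infty,u_0]$ and is positive on $(u_0,\infty)$. It is a candidate density and it is the unique (up to null sets) minimizer of $\Sigma_J$ over all candidate densities, and $$\min_\mu\Sigma_J(\mu)=\Sigma_J(\mu_*)=A^6\,\Phi_-\!\big(-a_0/A^2\big).$$ 2. $U(\mu_*)=0$, and $\mu_*$ is also the unique minimizer of $\Sigma$ over all candidate densities, with the same minimum $\Sigma(\mu_*)=A^6\,\Phi_-(-a_0/A^2)$. In particular $\min_\mu\Sigma(\mu)=\Phi_-(z)$ for $A=1$, $a_0=-z$. 3.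 If $A>0$ and $a_0>0$, then $0<u_0<a_0$, and $\mu_*$ has a logarithmic singularity at $a_0$: $\mu_*(a)/\log\frac{1}{|a-a_0|}\to\frac{A}{2\pi^2}$ as $a\to a_0$, $a\neq a_0$. 4. For all $A,B>0$ and $z\le0$ the following minimum over candidate densities is attained, and $$\min_\mu\Big[A\int_{\mathbb R}(-z-a)_+\,\mu(a)\,da+B\,I_{\rm Airy}(\mu)\Big]=\frac{A^6}{B^5}\,\Phi_-\!\Big(\frac{zB^2}{A^2}\Big).$$ -/

import Mathlib

open MeasureTheory Filter Topology Set
open scoped ENNReal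

noncomputable section

namespace AiryGas

/-- The reference density `μ_Airy(a) = π⁻¹ √a 1_{a > 0}`. -/
def airyDensity (a : ℝ) : ℝ := if 0 < a then Real.sqrt a / Real.pi else 0

/-- The charge of `μ` relative to `μ_Airy`. -/
def charge (μ : ℝ → ℝ) (a : ℝ) : ℝ := μ a - airyDensity a

/-- The integrand `log |a₁ - a₂| (μ - μ_Airy)(a₁) (μ - μ_Airy)(a₂)` of the logarithmic energy. -/
def energyIntegrand (μ : ℝ → ℝ) (p : ℝ × ℝ) : ℝ :=
  Real.log |p.1 - p.2| * (charge μ p.1 * charge μ p.2)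

/-- Candidate densities: (a.e.) nonnegative densities on `ℝ` with zero mass relative to `μ_Airy`,
for which the double integral that defines `J_Airy` converges absolutely. The two linear terms of
the cost functions below are nonnegative, are allowed to be infinite, and put no restriction on
the candidates. -/
structure Admissible (μ : ℝ → ℝ) : Prop where
  nonneg : ∀ᵐ a, 0 ≤ μ a
  integrable_charge : Integrable (charge μ)
  mass_balance : ∫ a, charge μ a = 0
  integrable_energy : Integrable (energyIntegrand μ)

/-- `J_Airy(μ) = -∬ log |a₁ - a₂| ∏ (μ(aᵢ) - μ_Airy(aᵢ)) da₁ da₂`. -/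
def airyJ (μ : ℝ → ℝ) : ℝ := -∫ p, energyIntegrand μ p

/-- `U(μ) = (4/3) ∫_{-∞}^0 |a|^{3/2} μ(a) da`, with values in `[0, ∞]`. -/
def airyU (μ : ℝ → ℝ) : ℝ≥0∞ :=
  ∫⁻ a in Iio (0 : ℝ), ENNReal.ofReal (4 / 3 * |a| ^ (3 / 2 : ℝ) * μ a)

/-- `I_Airy(μ) = J_Airy(μ) + U(μ)`, with values in `(-∞, ∞]`. -/
def airyI (μ : ℝ → ℝ) : EReal := (airyJ μ : EReal) + (airyU μ : EReal)

/-- `∫ (a₀ - a)₊ μ(a) da`, with values in `[0, ∞]`. -/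
def wall (a₀ : ℝ) (μ : ℝ → ℝ) : ℝ≥0∞ :=
  ∫⁻ a, ENNReal.ofReal (max (a₀ - a) 0 * μ a)

/-- `Σ_J(μ) = A ∫ (a₀ - a)₊ μ(a) da + J_Airy(μ)`, with values in `(-∞, ∞]`. -/
def sigmaJ (A a₀ : ℝ) (μ : ℝ → ℝ) : EReal :=
  (A : EReal) * (wall a₀ μ : EReal) + (airyJ μ : EReal)

/-- `Σ(μ) = A ∫ (a₀ - a)₊ μ(a) da + I_Airy(μ)`, with values in `(-∞, ∞]`. -/
def sigma (A a₀ : ℝ) (μ : ℝ → ℝ) : EReal :=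
  (A : EReal) * (wall a₀ μ : EReal) + airyI μ

/-- `m` minimizes `F` over the candidate densities, and every candidate that attains the minimum
agrees with `m` almost everywhere. -/
structure IsUniqueMinimizer (F : (ℝ → ℝ) → EReal) (m : ℝ → ℝ) : Prop where
  admissible : Admissible m
  le : ∀ μ, Admissible μ → F m ≤ F μ
  unique : ∀ μ, Admissible μ → F μ = F m → μ =ᵐ[volume] m

/-- The left edge `u₀ = (2A²/π²)(√(1 + π²a₀/A²) - 1)`. For `A = 0` this evaluates to `0`, the
limit as `A → 0`. -/
def leftEdge (A a₀ : ℝ) : ℝ :=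
  2 * A ^ 2 / Real.pi ^ 2 * (Real.sqrt (1 + Real.pi ^ 2 * a₀ / A ^ 2) - 1)

/-- The optimal density, with `u₀ = leftEdge A a₀` and `v₀ = a₀ - u₀`. -/
def optimalDensity (A a₀ : ℝ) (a : ℝ) : ℝ :=
  let u₀ := leftEdge A a₀
  let v₀ := a₀ - u₀
  if u₀ < a then
    1 / Real.pi * Real.sqrt (a - u₀) +
      A / (2 * Real.pi ^ 2) *
        Real.log |(Real.sqrt (a - u₀) + Real.sqrt v₀) / (Real.sqrt (a - u₀) - Real.sqrt v₀)|
  else 0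

/-- `Φ₋(z) = 4/(15π⁶) (1 - π²z)^{5/2} - 4/(15π⁶) + 2z/(3π⁴) - z²/(2π²)`. -/
def phiMinus (z : ℝ) : ℝ :=
  4 / (15 * Real.pi ^ 6) * (1 - Real.pi ^ 2 * z) ^ (5 / 2 : ℝ) - 4 / (15 * Real.pi ^ 6) +
    2 / (3 * Real.pi ^ 4) * z - 1 / (2 * Real.pi ^ 2) * z ^ 2

end AiryGas

end

/-!
# Minimisers of the Airy energy with a linear wall

The logarithmic energy of a neutral charge `ν` is positive definite. Indeed
`-log t = ∫₀^∞ ((s - t)₊ - (s - 1)₊) / s² ds`, and `(s - |x - y|)₊` is the length of the set of `z`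
whose window `(z, z + s]` contains both `x` and `y`, so that the energy equals
`∫₀^∞ s⁻² ∫ ν(z, z + s]² dz ds` (`neg_integral_log_eq`). Fubini's theorem applies as soon as the
energy converges absolutely, because the integrand in `s` has a constant sign. If the energy
vanishes, the windows of some fixed length carry no mass, hence `ν = 0`
(`ae_eq_zero_of_integral_log`).

The charge of the optimal density is a superposition `∫ m(u) 1_{u < a} / √(a - u) du` of half-line
densities (`charge_edgeDensity`). The weight `m` is `-1/(2π)` on `(0, u₀]` and
`A / (2π² √(a₀ - u))` on `(u₀, a₀]`; its total mass vanishes exactly because of the choice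
of `u₀`. Since the density `1/√(a - u)` has the logarithmic potential `2π √(u - a)₊`, up to a
divergent constant which neutrality removes, the potential of the optimal charge is
`∫ m(u) 2π √(u - a)₊ du` (`NeutralWeight.integral_log_mul_abel`). Evaluating it by a beta integral
gives the Euler–Lagrange relations: the potential equals `A (a₀ - a)₊ / 2` on the support of the
optimal density (`edgePotential_of_lt`) and is at most that elsewhere (`edgePotential_le`).

For a candidate `μ` put `ν = μ - μ_*`. Absolute convergence of the energy of `μ` forces a logarithmic
moment (`LogMoment.of_integrable_energy`), and together with the square integrability of the optimal
charge this makes all mutual energies converge. The energy of `μ` is then that of `μ_*`, plus the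
energy of `ν`, minus twice the integral of the potential against `ν`
(`EdgeRelation.airyJ_expand`); by the Euler–Lagrange relations the last term is dominated by the
difference of the linear costs (`EdgeRelation.linear_term_le`). Both minimality and uniqueness
follow. The term `U` is nonnegative and vanishes at `μ_*`, and a factor `B` in front of the energy is
absorbed by replacing `A` with `A / B`.

Throughout, `√x = 0` for `x ≤ 0` and `0⁻¹ = 0`, so `(√(a - u))⁻¹` stands for
`1_{u < a} / √(a - u)`, and `√(u - a)` for `√(u - a)₊`.
-/

namespace AiryGas

/-! ### Positive definiteness of the logarithmic energy -/

/-- The Frullani-type integral behind `-log t = ∫₀^∞ ((s - t)₊ - (s - 1)₊) / s² ds`. -/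
theorem integral_ramp_diff {a b : ℝ} (ha : 0 < a) (hab : a ≤ b) :
    IntegrableOn (fun s : ℝ => (max (s - a) 0 - max (s - b) 0) / s ^ 2) (Ioi 0) ∧
      ∫ s in Ioi (0 : ℝ), (max (s - a) 0 - max (s - b) 0) / s ^ 2 = Real.log b - Real.log a := by
  have hb : 0 < b := ha.trans_le hab
  have h1 : EqOn (fun s : ℝ => (max (s - a) 0 - max (s - b) 0) / s ^ 2) (fun _ => 0)
      (Ioc 0 a) := by
    intro s hs
    have h1 := hs.2
    simp [max_eq_right (sub_nonpos.2 h1), max_eq_right (sub_nonpos.2 (h1.trans hab))]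
  have h2 : EqOn (fun s : ℝ => (max (s - a) 0 - max (s - b) 0) / s ^ 2)
      (fun s => s⁻¹ - a * (s ^ 2)⁻¹) (Ioc a b) := by
    intro s hs
    have h0 : 0 < s := ha.trans hs.1
    simp only [max_eq_left (sub_nonneg.2 hs.1.le), max_eq_right (sub_nonpos.2 hs.2)]
    field_simp
    ring
  have h3 : EqOn (fun s : ℝ => (max (s - a) 0 - max (s - b) 0) / s ^ 2)
      (fun s => (b - a) * (s ^ 2)⁻¹) (Ioi b) := by
    intro s hs
    have hs' : b < s := hs
    simp only [max_eq_left (sub_nonneg.2 (hab.trans hs'.le)), max_eq_left (sub_nonneg.2 hs'.le)]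
    rw [div_eq_mul_inv]; ring
  have d3 : ∀ x ∈ Ioi b, HasDerivAt (fun s : ℝ => -(b - a) * s⁻¹) ((b - a) * (x ^ 2)⁻¹) x := by
    intro x hx
    have hx' : b < x := hx
    convert! (hasDerivAt_inv (hb.trans hx').ne').const_mul (-(b - a)) using 1
    ring
  have t3 : Tendsto (fun s : ℝ => -(b - a) * s⁻¹) atTop (𝓝 0) := by
    simpa using tendsto_inv_atTop_zero.const_mul (-(b - a))
  have c3 : ContinuousWithinAt (fun s : ℝ => -(b - a) * s⁻¹) (Ici b) b :=
    (continuousAt_const.mul (continuousAt_inv₀ hb.ne')).continuousWithinAt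
  have p3 : ∀ x ∈ Ioi b, 0 ≤ (b - a) * (x ^ 2)⁻¹ := fun x _ => by
    have := sub_nonneg.2 hab
    positivity
  have i3 := integrableOn_Ioi_deriv_of_nonneg c3 d3 p3 t3
  have e3 := integral_Ioi_of_hasDerivAt_of_nonneg c3 d3 p3 t3
  have d2 : ∀ x ∈ uIcc a b, HasDerivAt (fun s : ℝ => Real.log s + a * s⁻¹)
      (x⁻¹ - a * (x ^ 2)⁻¹) x := by
    intro x hx
    rw [uIcc_of_le hab] at hx
    have hx' : x ≠ 0 := (ha.trans_le hx.1).ne'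
    convert! (Real.hasDerivAt_log hx').add ((hasDerivAt_inv hx').const_mul a) using 1
    ring
  have i2 : IntervalIntegrable (fun s : ℝ => s⁻¹ - a * (s ^ 2)⁻¹) volume a b := by
    apply ContinuousOn.intervalIntegrable
    rw [uIcc_of_le hab]
    have hn : ∀ x ∈ Icc a b, x ≠ 0 := fun x hx => (ha.trans_le hx.1).ne'
    exact (continuousOn_id.inv₀ hn).sub
      (continuousOn_const.mul ((continuousOn_id.pow 2).inv₀ fun x hx => pow_ne_zero 2 (hn x hx)))
  have e2 := intervalIntegral.integral_eq_sub_of_hasDerivAt d2 i2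
  rw [intervalIntegral.integral_of_le hab] at e2
  rw [intervalIntegrable_iff_integrableOn_Ioc_of_le hab] at i2
  have j1 := (integrableOn_congr_fun (μ := volume) h1 measurableSet_Ioc).2 integrableOn_zero
  have j2 := (integrableOn_congr_fun h2 measurableSet_Ioc).2 i2
  have j3 := (integrableOn_congr_fun h3 measurableSet_Ioi).2 i3
  have u : Ioi (0 : ℝ) = Ioc 0 a ∪ (Ioc a b ∪ Ioi b) := by
    rw [Ioc_union_Ioi_eq_Ioi hab, Ioc_union_Ioi_eq_Ioi ha.le]
  refine ⟨by rw [u]; exact j1.union (j2.union j3), ?_⟩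
  rw [u, setIntegral_union (by
      rw [Ioc_union_Ioi_eq_Ioi hab, Set.disjoint_left]; exact fun x hx hx' => not_lt.2 hx.2 hx')
      (measurableSet_Ioc.union measurableSet_Ioi) j1 (j2.union j3),
    setIntegral_union (by
      rw [Set.disjoint_left]; exact fun x hx hx' => not_lt.2 hx.2 hx') measurableSet_Ioi j2 j3,
    setIntegral_congr_fun measurableSet_Ioc h1, setIntegral_congr_fun measurableSet_Ioc h2,
    setIntegral_congr_fun measurableSet_Ioi h3, e2, e3]
  simp only [integral_zero]
  field_simp
  ring

/-- The normalised ramp at scale `s`, whose superposition over `s` is the logarithmic kernel. -/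
noncomputable def rampKernel (t s : ℝ) : ℝ := (max (s - t) 0 - max (s - 1) 0) / s ^ 2

theorem measurable_rampKernel : Measurable (fun p : ℝ × ℝ => rampKernel p.1 p.2) := by
  unfold rampKernel
  fun_prop

/-- Since the ramp kernel has a constant sign in `s`, its integral and the integral of its modulus
carry the same information. -/
theorem integral_rampKernel {t : ℝ} (ht : 0 < t) :
    IntegrableOn (rampKernel t) (Ioi 0) ∧
      ∫ s in Ioi (0 : ℝ), rampKernel t s = -Real.log t ∧
      ∫ s in Ioi (0 : ℝ), ‖rampKernel t s‖ = |Real.log t| := by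
  rcases le_total t 1 with h | h
  · obtain ⟨h1, h2⟩ := integral_ramp_diff ht h
    rw [Real.log_one, zero_sub] at h2
    refine ⟨h1, h2, ?_⟩
    rw [abs_of_nonpos (Real.log_nonpos ht.le h), ← h2]
    refine integral_congr_ae (Eventually.of_forall fun s => ?_)
    refine Real.norm_of_nonneg (div_nonneg (sub_nonneg.2 ?_) (sq_nonneg s))
    exact max_le_max (by linarith) le_rfl
  · obtain ⟨h1, h2⟩ := integral_ramp_diff one_pos h
    rw [Real.log_one, sub_zero] at h2
    have e : ∀ s, rampKernel t s = -((max (s - 1) 0 - max (s - t) 0) / s ^ 2) := by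
      intro s; unfold rampKernel; ring
    have e' : rampKernel t = fun s => -((max (s - 1) 0 - max (s - t) 0) / s ^ 2) := funext e
    refine ⟨by rw [e']; exact h1.neg, by rw [e', integral_neg, h2], ?_⟩
    rw [abs_of_nonneg (Real.log_nonneg h), ← h2]
    refine integral_congr_ae (Eventually.of_forall fun s => ?_)
    simp only [e, norm_neg]
    refine Real.norm_of_nonneg (div_nonneg (sub_nonneg.2 ?_) (sq_nonneg s))
    exact max_le_max (by linarith) le_rfl

/-- Two points at distance `d` lie in a common window `(z, z + s]` for a set of `z` of
length `(s - d)₊`. -/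
theorem integral_window_mul_window {s : ℝ} (x y : ℝ) :
    Integrable (fun z : ℝ => (Ioc z (z + s)).indicator (fun _ => (1 : ℝ)) x *
        (Ioc z (z + s)).indicator (fun _ => (1 : ℝ)) y) ∧
      ∫ z : ℝ, (Ioc z (z + s)).indicator (fun _ => (1 : ℝ)) x *
        (Ioc z (z + s)).indicator (fun _ => (1 : ℝ)) y = max (s - |x - y|) 0 := by
  have h : (fun z : ℝ => (Ioc z (z + s)).indicator (fun _ => (1 : ℝ)) x *
      (Ioc z (z + s)).indicator (fun _ => (1 : ℝ)) y) =
      (Ico (max x y - s) (min x y)).indicator (fun _ => (1 : ℝ)) := by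
    funext z
    simp only [indicator_apply, mem_Ioc, mem_Ico, sub_le_iff_le_add, max_le_iff, lt_min_iff]
    split_ifs <;> first | (exfalso; tauto) | simp
  rw [h]
  refine ⟨(integrable_indicator_iff measurableSet_Ico).2 (by simp), ?_⟩
  rw [integral_indicator measurableSet_Ico]
  simp only [integral_const, MeasurableSet.univ, measureReal_restrict_apply, univ_inter,
    smul_eq_mul, mul_one, Real.volume_real_Ico]
  congr 1
  rw [← max_sub_min_eq_abs']
  ring

/-- The mass of `ν` in the window `(z, z + s]`. -/
noncomputable def windowMass (ν : ℝ → ℝ) (s z : ℝ) : ℝ := ∫ x in Ioc z (z + s), ν x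

theorem measurableSet_window (s : ℝ) : MeasurableSet {q : ℝ × ℝ | q.1 ∈ Ioc q.2 (q.2 + s)} := by
  apply MeasurableSet.inter
  · exact measurableSet_lt measurable_snd measurable_fst
  · exact measurableSet_le measurable_fst (measurable_snd.add_const s)

/-- The ramp kernel is positive semidefinite: its quadratic form is the `L²` norm of the window
masses. -/
theorem integral_ramp_mul {ν : ℝ → ℝ} (hν : Integrable ν) {s : ℝ} (hs : 0 ≤ s) :
    Integrable (fun z => windowMass ν s z ^ 2) ∧
      ∫ p : ℝ × ℝ, max (s - |p.1 - p.2|) 0 * (ν p.1 * ν p.2) = ∫ z, windowMass ν s z ^ 2 := by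
  set K : ℝ → ℝ → ℝ := fun z x => (Ioc z (z + s)).indicator (fun _ => (1 : ℝ)) x with hK
  have hKm : Measurable (fun q : ℝ × ℝ => K q.2 q.1) := by
    have : (fun q : ℝ × ℝ => K q.2 q.1) =
        {q : ℝ × ℝ | q.1 ∈ Ioc q.2 (q.2 + s)}.indicator (fun _ => (1 : ℝ)) := by
      funext q; simp [hK, indicator_apply]
    rw [this]
    exact measurable_const.indicator (measurableSet_window s)
  have hK0 : ∀ z x, 0 ≤ K z x := fun z x => indicator_nonneg (fun _ _ => zero_le_one) x
  have hνν : Integrable (fun p : ℝ × ℝ => ν p.1 * ν p.2) := hν.mul_prod hν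
  set G : ℝ × ℝ → ℝ → ℝ := fun p z => K z p.1 * K z p.2 * (ν p.1 * ν p.2) with hG
  have hGm : AEStronglyMeasurable (Function.uncurry G)
      ((volume : Measure (ℝ × ℝ)).prod (volume : Measure ℝ)) := by
    refine AEStronglyMeasurable.mul (Measurable.aestronglyMeasurable ?_) ?_
    · exact (hKm.comp (f := fun q : (ℝ × ℝ) × ℝ => (q.1.1, q.2)) (by fun_prop)).mul
        (hKm.comp (f := fun q : (ℝ × ℝ) × ℝ => (q.1.2, q.2)) (by fun_prop))
    · exact hνν.aestronglyMeasurable.comp_fst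
  have hGi : Integrable (Function.uncurry G)
      ((volume : Measure (ℝ × ℝ)).prod (volume : Measure ℝ)) := by
    rw [integrable_prod_iff hGm]
    refine ⟨Eventually.of_forall fun p =>
      (integral_window_mul_window p.1 p.2).1.mul_const (ν p.1 * ν p.2), ?_⟩
    have : (fun p : ℝ × ℝ => ∫ z, ‖Function.uncurry G (p, z)‖) =
        fun p => max (s - |p.1 - p.2|) 0 * ‖ν p.1 * ν p.2‖ := by
      funext p
      rw [← (integral_window_mul_window p.1 p.2).2, ← integral_mul_const]
      refine integral_congr_ae (Eventually.of_forall fun z => ?_)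
      simp only [Function.uncurry, hG, norm_mul, Real.norm_of_nonneg (hK0 _ _)]
      rfl
    rw [this]
    refine hνν.norm.bdd_mul (c := s) (Measurable.aestronglyMeasurable (by fun_prop))
      (Eventually.of_forall fun p => ?_)
    rw [Real.norm_of_nonneg (le_max_right _ _)]
    exact max_le (by linarith [abs_nonneg (p.1 - p.2)]) hs
  have hz : ∀ z, ∫ p, G p z = windowMass ν s z ^ 2 := by
    intro z
    have e : (fun p : ℝ × ℝ => G p z) = fun p => (K z p.1 * ν p.1) * (K z p.2 * ν p.2) := by
      funext p; simp only [hG]; ring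
    rw [e, Measure.volume_eq_prod,
      integral_prod_mul (fun x => K z x * ν x) (fun x => K z x * ν x), windowMass, sq]
    have e' : (fun x => K z x * ν x) = (Ioc z (z + s)).indicator ν := by
      funext x; simp only [hK, indicator_apply]; split_ifs <;> simp
    rw [e', integral_indicator measurableSet_Ioc]
  have hp : ∀ p : ℝ × ℝ, ∫ z, G p z = max (s - |p.1 - p.2|) 0 * (ν p.1 * ν p.2) := by
    intro p
    rw [← (integral_window_mul_window p.1 p.2).2, ← integral_mul_const]
  constructor
  · refine (hGi.integral_prod_right).congr (Eventually.of_forall fun z => ?_)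
    exact hz z
  · simp_rw [← hp, ← hz]
    exact integral_integral_swap hGi

theorem ae_fst_ne_snd : ∀ᵐ p : ℝ × ℝ, p.1 ≠ p.2 := by
  have hm : MeasurableSet {p : ℝ × ℝ | p.1 = p.2} := measurableSet_eq_fun measurable_fst measurable_snd
  have : (volume : Measure (ℝ × ℝ)) {p : ℝ × ℝ | p.1 = p.2} = 0 := by
    rw [Measure.volume_eq_prod, Measure.measure_prod_null hm]
    refine Eventually.of_forall fun x => ?_
    have : Prod.mk x ⁻¹' {p : ℝ × ℝ | p.1 = p.2} = {x} := by
      ext y; simp [eq_comm]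
    simp [this]
  rw [ae_iff]; simpa using this

/-- A neutral charge of finite logarithmic energy: the energy is a superposition over all scales of
the `L²` norms of the window masses. -/
theorem neg_integral_log_eq {ν : ℝ → ℝ} (hν : Integrable ν) (h0 : ∫ x, ν x = 0)
    (hE : Integrable fun p : ℝ × ℝ => Real.log |p.1 - p.2| * (ν p.1 * ν p.2)) :
    IntegrableOn (fun s => (∫ z, windowMass ν s z ^ 2) / s ^ 2) (Ioi 0) ∧
    -∫ p : ℝ × ℝ, Real.log |p.1 - p.2| * (ν p.1 * ν p.2) =
      ∫ s in Ioi (0 : ℝ), (∫ z, windowMass ν s z ^ 2) / s ^ 2 := by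
  have hνν : Integrable (fun p : ℝ × ℝ => ν p.1 * ν p.2) := hν.mul_prod hν
  set G : ℝ × ℝ → ℝ → ℝ := fun p s => rampKernel |p.1 - p.2| s * (ν p.1 * ν p.2) with hG
  have hGm : AEStronglyMeasurable (Function.uncurry G)
      ((volume : Measure (ℝ × ℝ)).prod (volume.restrict (Ioi (0 : ℝ)))) := by
    refine AEStronglyMeasurable.mul (Measurable.aestronglyMeasurable ?_) ?_
    · exact measurable_rampKernel.comp (f := fun q : (ℝ × ℝ) × ℝ => (|q.1.1 - q.1.2|, q.2))
        (by fun_prop)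
    · exact hνν.aestronglyMeasurable.comp_fst
  have hGi : Integrable (Function.uncurry G)
      ((volume : Measure (ℝ × ℝ)).prod (volume.restrict (Ioi (0 : ℝ)))) := by
    rw [integrable_prod_iff hGm]
    constructor
    · filter_upwards [ae_fst_ne_snd] with p hp
      exact (integral_rampKernel (abs_pos.2 (sub_ne_zero.2 hp))).1.mul_const (ν p.1 * ν p.2)
    · refine hE.norm.congr ?_
      filter_upwards [ae_fst_ne_snd] with p hp
      simp only [Function.uncurry, hG, norm_mul, integral_mul_const]
      rw [(integral_rampKernel (abs_pos.2 (sub_ne_zero.2 hp))).2.2]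
      rfl
  have hs : ∀ s ∈ Ioi (0 : ℝ), ∫ p, G p s = (∫ z, windowMass ν s z ^ 2) / s ^ 2 := by
    intro s hs
    have hs' : (0 : ℝ) < s := hs
    rw [← (integral_ramp_mul hν hs'.le).2]
    -- neutrality removes the normalising term `(s - 1)₊`, which does not depend on the points
    have e : (fun p : ℝ × ℝ => G p s) = fun p : ℝ × ℝ =>
        (max (s - |p.1 - p.2|) 0 * (ν p.1 * ν p.2)) / s ^ 2 -
          max (s - 1) 0 / s ^ 2 * (ν p.1 * ν p.2) := by
      funext p; simp only [hG, rampKernel]; ring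
    have hi : Integrable fun p : ℝ × ℝ => max (s - |p.1 - p.2|) 0 * (ν p.1 * ν p.2) := by
      refine hνν.bdd_mul (c := s) (Measurable.aestronglyMeasurable (by fun_prop))
        (Eventually.of_forall fun p => ?_)
      rw [Real.norm_of_nonneg (le_max_right _ _)]
      exact max_le (by linarith [abs_nonneg (p.1 - p.2)]) hs'.le
    rw [e, integral_sub (hi.div_const _) (hνν.const_mul _), integral_div, integral_const_mul,
      Measure.volume_eq_prod, integral_prod_mul ν ν, h0]
    simp
  constructor
  · refine (integrable_congr ?_).1 hGi.integral_prod_right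
    filter_upwards [ae_restrict_mem measurableSet_Ioi] with s hs'
    exact hs s hs'
  · rw [← setIntegral_congr_fun measurableSet_Ioi hs, ← integral_integral_swap hGi, ← integral_neg]
    refine integral_congr_ae ?_
    filter_upwards [ae_fst_ne_snd] with p hp
    simp only [hG, integral_mul_const]
    rw [(integral_rampKernel (abs_pos.2 (sub_ne_zero.2 hp))).2.1]
    ring

theorem integral_windowMass_div_nonneg (ν : ℝ → ℝ) (s : ℝ) :
    0 ≤ (∫ z, windowMass ν s z ^ 2) / s ^ 2 :=
  div_nonneg (integral_nonneg fun _ => sq_nonneg _) (sq_nonneg s)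

theorem neg_integral_log_nonneg {ν : ℝ → ℝ} (hν : Integrable ν) (h0 : ∫ x, ν x = 0)
    (hE : Integrable fun p : ℝ × ℝ => Real.log |p.1 - p.2| * (ν p.1 * ν p.2)) :
    0 ≤ -∫ p : ℝ × ℝ, Real.log |p.1 - p.2| * (ν p.1 * ν p.2) := by
  rw [(neg_integral_log_eq hν h0 hE).2]
  exact integral_nonneg fun s => integral_windowMass_div_nonneg ν s

theorem tendsto_integral_add_nat_mul {ν : ℝ → ℝ} (hν : Integrable ν) (x : ℝ) {s : ℝ} (hs : 0 < s) :
    Tendsto (fun n : ℕ => ∫ y in (0 : ℝ)..(x + n * s), ν y) atTop (𝓝 (∫ y in Ioi (0 : ℝ), ν y)) :=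
  intervalIntegral_tendsto_integral_Ioi 0 hν.integrableOn
    (tendsto_atTop_add_const_left _ x (tendsto_natCast_atTop_atTop.atTop_mul_const hs))

/-- If all windows of one fixed length carry no mass, the primitive of `ν` is periodic; having a
limit at infinity, it is constant. -/
theorem ae_eq_zero_of_windowMass {ν : ℝ → ℝ} (hν : Integrable ν) {s : ℝ} (hs : 0 < s)
    (h : ∀ᵐ z, windowMass ν s z = 0) : ν =ᵐ[volume] 0 := by
  set Φ : ℝ → ℝ := fun x => ∫ y in (0 : ℝ)..x, ν y with hΦ
  have hi : ∀ a b : ℝ, IntervalIntegrable ν volume a b := fun a b => hν.intervalIntegrable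
  have hc : Continuous Φ := intervalIntegral.continuous_primitive hi 0
  have hw : ∀ z, windowMass ν s z = Φ (z + s) - Φ z := by
    intro z
    rw [windowMass, ← intervalIntegral.integral_of_le (by linarith),
      intervalIntegral.integral_interval_sub_left (hi _ _) (hi _ _)]
  have hper : ∀ z, Φ (z + s) = Φ z := by
    have h1 : (fun z => Φ (z + s)) =ᵐ[volume] Φ := by
      filter_upwards [h] with z hz
      rw [hw] at hz; linarith
    have := Continuous.ae_eq_iff_eq volume (hc.comp (continuous_add_const s)) hc |>.1 h1
    exact fun z => congrFun this z
  have hpern : ∀ z (n : ℕ), Φ (z + n * s) = Φ z := by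
    intro z n
    induction n with
    | zero => simp
    | succ n ih => rw [← ih, ← hper (z + n * s)]; push_cast; ring_nf
  have hconst : ∀ z, Φ z = ∫ y in Ioi (0 : ℝ), ν y := by
    intro z
    have := tendsto_integral_add_nat_mul hν z hs
    refine tendsto_nhds_unique ?_ this
    exact tendsto_const_nhds.congr fun n => (hpern z n).symm
  have hzero : Φ = fun _ => (0 : ℝ) := by
    funext z
    rw [hconst z, ← hconst 0]
    simp [hΦ]
  filter_upwards [LocallyIntegrable.ae_hasDerivAt_integral hν.locallyIntegrable] with x hx
  have h1 := hx 0
  have h2 : HasDerivAt Φ (ν x) x := h1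
  rw [hzero] at h2
  exact h2.unique (hasDerivAt_const x (0 : ℝ))

theorem ae_eq_zero_of_integral_log {ν : ℝ → ℝ} (hν : Integrable ν) (h0 : ∫ x, ν x = 0)
    (hE : Integrable fun p : ℝ × ℝ => Real.log |p.1 - p.2| * (ν p.1 * ν p.2))
    (h : -∫ p : ℝ × ℝ, Real.log |p.1 - p.2| * (ν p.1 * ν p.2) = 0) : ν =ᵐ[volume] 0 := by
  obtain ⟨h1, h2⟩ := neg_integral_log_eq hν h0 hE
  rw [h, eq_comm, integral_eq_zero_iff_of_nonneg (fun s => integral_windowMass_div_nonneg ν s) h1,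
    EventuallyEq, ae_restrict_iff' measurableSet_Ioi] at h2
  obtain ⟨s, hs, hs'⟩ : ∃ s : ℝ, 0 < s ∧ (∫ z, windowMass ν s z ^ 2) / s ^ 2 = 0 := by
    by_contra! hcon
    have : (volume : Measure ℝ) (Ioi 0) = 0 := by
      refine measure_mono_null (fun s hs => ?_) (ae_iff.1 h2)
      exact fun hz => hcon s hs (hz hs)
    simp at this
  have hs2 : ∫ z, windowMass ν s z ^ 2 = 0 := by
    rcases div_eq_zero_iff.1 hs' with h | h
    · exact h
    · exact absurd h (by positivity)
  rw [integral_eq_zero_iff_of_nonneg (fun _ => sq_nonneg _) (integral_ramp_mul hν hs.le).1] at hs2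
  refine ae_eq_zero_of_windowMass hν hs ?_
  filter_upwards [hs2] with z hz
  simpa using hz

/-! ### Logarithmic moments and absolute convergence -/

/-- An integrable charge with a finite logarithmic moment. -/
structure LogMoment (f : ℝ → ℝ) : Prop where
  integrable : Integrable f
  log : Integrable fun x => Real.log (1 + |x|) * f x

/-- The singular part of the logarithm. -/
noncomputable def nearLog (t : ℝ) : ℝ := (Icc (-1 : ℝ) 1).indicator Real.log t

theorem abs_log_sub_le (x y : ℝ) :
    |Real.log (x - y)| ≤ Real.log (1 + |x|) + Real.log (1 + |y|) + |nearLog (x - y)| := by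
  have hx : 0 ≤ Real.log (1 + |x|) := Real.log_nonneg (by linarith [abs_nonneg x])
  have hy : 0 ≤ Real.log (1 + |y|) := Real.log_nonneg (by linarith [abs_nonneg y])
  by_cases h : x - y ∈ Icc (-1 : ℝ) 1
  · rw [nearLog, indicator_of_mem h]; linarith
  · have h1 : 1 < |x - y| := by
      rw [← not_le, abs_le]; exact h
    have h2 : 0 ≤ Real.log |x - y| := Real.log_nonneg h1.le
    rw [← Real.log_abs, abs_of_nonneg h2, nearLog, indicator_of_notMem h, abs_zero, add_zero,
      ← Real.log_mul (by positivity) (by positivity)]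
    apply Real.log_le_log (by linarith)
    calc |x - y| ≤ |x| + |y| := abs_sub x y
      _ ≤ (1 + |x|) * (1 + |y|) := by nlinarith [abs_nonneg x, abs_nonneg y]

theorem log_one_add_abs_le (x y : ℝ) :
    Real.log (1 + |y|) ≤ Real.log (2 + |x|) + |Real.log (x - y)| := by
  have hx := abs_nonneg x
  have hy := abs_nonneg y
  have htri : |y| ≤ |x| + |x - y| := by
    have := abs_sub_abs_le_abs_sub y x
    rw [abs_sub_comm] at this; linarith
  rcases le_total |x - y| 1 with h | h
  · have : Real.log (1 + |y|) ≤ Real.log (2 + |x|) :=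
      Real.log_le_log (by linarith) (by linarith)
    linarith [abs_nonneg (Real.log (x - y))]
  · rw [← Real.log_abs (x - y), abs_of_nonneg (Real.log_nonneg h), ← Real.log_mul (by positivity) (by positivity)]
    apply Real.log_le_log (by linarith)
    nlinarith

/-- The square of the logarithm is locally integrable, since `|log t| ≤ 4 |t|^(-1/4)` near `0`. -/
theorem intervalIntegrable_log_sq (a b : ℝ) :
    IntervalIntegrable (fun t => Real.log t ^ 2) volume a b := by
  have key : ∀ c : ℝ, 1 ≤ c → IntervalIntegrable (fun t => Real.log t ^ 2) volume 0 c := by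
    intro c hc
    have h1 : IntervalIntegrable (fun t => Real.log t ^ 2) volume 1 c := by
      apply ContinuousOn.intervalIntegrable
      rw [uIcc_of_le hc]
      exact (Real.continuousOn_log.mono fun x hx => by
        have := hx.1
        simp; linarith).pow 2
    refine IntervalIntegrable.trans ?_ h1
    have hr : IntervalIntegrable (fun t : ℝ => 16 * t ^ (-(1 / 2) : ℝ)) volume 0 1 :=
      (intervalIntegral.intervalIntegrable_rpow' (by norm_num)).const_mul 16
    refine hr.mono_fun' (Real.measurable_log.pow_const 2).aestronglyMeasurable ?_
    rw [uIoc_of_le zero_le_one]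
    filter_upwards [ae_restrict_mem measurableSet_Ioc] with t ht
    have h2 := Real.abs_log_mul_self_rpow_lt t (1 / 4) ht.1 ht.2 (by norm_num)
    have hp : 0 < t ^ (1 / 4 : ℝ) := Real.rpow_pos_of_pos ht.1 _
    have hs : (Real.log t * t ^ (1 / 4 : ℝ)) ^ 2 ≤ 16 := by
      rw [← sq_abs]; nlinarith [abs_nonneg (Real.log t * t ^ (1 / 4 : ℝ))]
    have hq : (t ^ (1 / 4 : ℝ)) ^ 2 * t ^ (-(1 / 2) : ℝ) = 1 := by
      rw [← Real.rpow_natCast, ← Real.rpow_mul ht.1.le, ← Real.rpow_add ht.1]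
      norm_num
    have hr0 : 0 < t ^ (-(1 / 2) : ℝ) := Real.rpow_pos_of_pos ht.1 _
    rw [Real.norm_of_nonneg (sq_nonneg _)]
    calc Real.log t ^ 2 = (Real.log t * t ^ (1 / 4 : ℝ)) ^ 2 * t ^ (-(1 / 2) : ℝ) := by
          rw [mul_pow, mul_assoc, hq, mul_one]
      _ ≤ 16 * t ^ (-(1 / 2) : ℝ) := by gcongr
  have key' : ∀ c : ℝ, 1 ≤ c → IntervalIntegrable (fun t => Real.log t ^ 2) volume (-c) c := by
    intro c hc
    have h1 := (IntervalIntegrable.iff_comp_neg).1 (key c hc)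
    simp only [Real.log_neg_eq_log, neg_zero] at h1
    exact h1.symm.trans (key c hc)
  have hc : 1 ≤ max (max |a| |b|) 1 := le_max_right _ _
  refine (key' _ hc).mono_set ?_
  rw [uIcc_of_le (by linarith : -max (max |a| |b|) 1 ≤ max (max |a| |b|) 1)]
  refine uIcc_subset_Icc ?_ ?_ <;> refine abs_le.1 ?_ <;> simp

theorem integrable_nearLog_sq : Integrable fun t => nearLog t ^ 2 := by
  have h := intervalIntegrable_log_sq (-1) 1
  rw [intervalIntegrable_iff_integrableOn_Icc_of_le (by norm_num)] at h
  have e : (fun t => nearLog t ^ 2) = (Icc (-1 : ℝ) 1).indicator fun t => Real.log t ^ 2 := by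
    funext t; simp only [nearLog, indicator_apply]; split_ifs <;> simp
  rw [e]
  exact (integrable_indicator_iff measurableSet_Icc).2 h

/-- `log |x - y| f(x) g(y)` is integrable on the plane if both charges have a logarithmic moment
and one of them is square integrable. The singularity of the kernel is absorbed by
`2|nearLog (x - y) g(y)| ≤ nearLog (x - y)² + g(y)²`. -/
theorem LogMoment.integrable_log_mul {f g : ℝ → ℝ} (hf : LogMoment f) (hg : LogMoment g)
    (hg2 : Integrable fun x => g x ^ 2) :
    Integrable fun p : ℝ × ℝ => Real.log |p.1 - p.2| * (f p.1 * g p.2) := by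
  have i1 := hf.log.norm.mul_prod hg.integrable.norm
  have i2 := hf.integrable.norm.mul_prod hg.log.norm
  have i3 := hf.integrable.norm.mul_prod hg2
  have i4 : Integrable fun p : ℝ × ℝ => ‖f p.1‖ * nearLog (p.1 - p.2) ^ 2 := by
    have h := hf.integrable.norm.mul_prod integrable_nearLog_sq
    have mp : MeasurePreserving (fun p : ℝ × ℝ => (p.1, p.1 - p.2))
        ((volume : Measure ℝ).prod (volume : Measure ℝ)) (volume.prod volume) :=
      (MeasurePreserving.id volume).skew_product (g := fun x y : ℝ => x - y) (by fun_prop)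
        (Eventually.of_forall fun x => (volume.measurePreserving_sub_left x).map_eq)
    exact mp.integrable_comp_of_integrable h
  refine (((i1.add i2).add i4).add i3).mono' ?_ (Eventually.of_forall fun p => ?_)
  · exact (Measurable.aestronglyMeasurable (by fun_prop)).mul
      (hf.integrable.mul_prod hg.integrable).aestronglyMeasurable
  · have hb := abs_log_sub_le p.1 p.2
    have hx : 0 ≤ Real.log (1 + |p.1|) := Real.log_nonneg (by linarith [abs_nonneg p.1])
    have hy : 0 ≤ Real.log (1 + |p.2|) := Real.log_nonneg (by linarith [abs_nonneg p.2])
    have hn : |nearLog (p.1 - p.2)| * |g p.2| ≤ nearLog (p.1 - p.2) ^ 2 + g p.2 ^ 2 := by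
      rw [← sq_abs (nearLog _), ← sq_abs (g _)]
      nlinarith [sq_nonneg (|nearLog (p.1 - p.2)| - |g p.2|),
        mul_nonneg (abs_nonneg (nearLog (p.1 - p.2))) (abs_nonneg (g p.2))]
    simp only [norm_mul, Real.norm_eq_abs, Pi.add_apply, Real.log_abs, abs_of_nonneg hx, abs_of_nonneg hy]
    calc |Real.log (p.1 - p.2)| * (|f p.1| * |g p.2|)
        ≤ (Real.log (1 + |p.1|) + Real.log (1 + |p.2|) + |nearLog (p.1 - p.2)|) *
            (|f p.1| * |g p.2|) := by gcongr
      _ = Real.log (1 + |p.1|) * |f p.1| * |g p.2| + |f p.1| * (Real.log (1 + |p.2|) * |g p.2|) +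
            |f p.1| * (|nearLog (p.1 - p.2)| * |g p.2|) := by ring
      _ ≤ Real.log (1 + |p.1|) * |f p.1| * |g p.2| + |f p.1| * (Real.log (1 + |p.2|) * |g p.2|) +
            |f p.1| * (nearLog (p.1 - p.2) ^ 2 + g p.2 ^ 2) := by gcongr
      _ = _ := by ring

/-- The logarithmic potential of a square integrable charge converges at every point. -/
theorem LogMoment.integrable_log_sub_mul {g : ℝ → ℝ} (hg : LogMoment g)
    (hg2 : Integrable fun x => g x ^ 2) (a : ℝ) :
    Integrable fun b => Real.log |a - b| * g b := by
  have i1 := hg.integrable.norm.const_mul (Real.log (1 + |a|))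
  have i2 : Integrable fun b => nearLog (a - b) ^ 2 := integrable_nearLog_sq.comp_sub_left a
  refine (((i1.add hg.log.norm).add i2).add hg2).mono' ?_ (Eventually.of_forall fun b => ?_)
  · exact (Measurable.aestronglyMeasurable (by fun_prop)).mul hg.integrable.aestronglyMeasurable
  · have hb := abs_log_sub_le a b
    have hy : 0 ≤ Real.log (1 + |b|) := Real.log_nonneg (by linarith [abs_nonneg b])
    have hn : |nearLog (a - b)| * |g b| ≤ nearLog (a - b) ^ 2 + g b ^ 2 := by
      rw [← sq_abs (nearLog _), ← sq_abs (g _)]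
      nlinarith [sq_nonneg (|nearLog (a - b)| - |g b|),
        mul_nonneg (abs_nonneg (nearLog (a - b))) (abs_nonneg (g b))]
    simp only [norm_mul, Real.norm_eq_abs, Pi.add_apply, Real.log_abs, abs_of_nonneg hy]
    calc |Real.log (a - b)| * |g b|
        ≤ (Real.log (1 + |a|) + Real.log (1 + |b|) + |nearLog (a - b)|) * |g b| := by gcongr
      _ ≤ _ := by linarith

/-- Absolute convergence of the logarithmic energy forces a logarithmic moment: freeze one
variable at a point where the charge does not vanish. -/
theorem LogMoment.of_integrable_energy {f : ℝ → ℝ} (hf : Integrable f)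
    (hE : Integrable fun p : ℝ × ℝ => Real.log |p.1 - p.2| * (f p.1 * f p.2)) :
    LogMoment f := by
  refine ⟨hf, ?_⟩
  by_cases h0 : f =ᵐ[volume] 0
  · refine (integrable_zero ℝ ℝ volume).congr ?_
    filter_upwards [h0] with x hx
    simp [hx]
  · have h1 := hE.prod_right_ae
    obtain ⟨x, hx, hfx⟩ : ∃ x, Integrable (fun y => Real.log |x - y| * (f x * f y)) ∧ f x ≠ 0 := by
      by_contra! hcon
      exact h0 (by filter_upwards [h1] with x hx using hcon x hx)
    have h2 : Integrable fun y => Real.log |x - y| * f y := by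
      refine (hx.const_mul (f x)⁻¹).congr (Eventually.of_forall fun y => ?_)
      field_simp
    refine ((hf.norm.const_mul (Real.log (2 + |x|))).add h2.norm).mono' ?_
      (Eventually.of_forall fun y => ?_)
    · exact (Measurable.aestronglyMeasurable (by fun_prop)).mul hf.aestronglyMeasurable
    · have hy : 0 ≤ Real.log (1 + |y|) := Real.log_nonneg (by linarith [abs_nonneg y])
      have := log_one_add_abs_le x y
      simp only [norm_mul, Real.norm_eq_abs, Pi.add_apply, Real.log_abs, abs_of_nonneg hy, ← add_mul]
      gcongr

/-! ### Elementary integrals with square-root singularities -/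

/-- The fundamental theorem of calculus for a nonnegative derivative, which is then automatically
integrable; the derivative may fail to exist at one point `c`. -/
theorem integral_of_deriv_nonneg {f f' : ℝ → ℝ} {p q : ℝ} (c : ℝ) (hpq : p ≤ q)
    (hf : ContinuousOn f (Icc p q))
    (hd : ∀ x ∈ Ioo p q, x ≠ c → HasDerivAt f (f' x) x) (hn : ∀ x ∈ Ioo p q, 0 ≤ f' x) :
    IntervalIntegrable f' volume p q ∧ ∫ x in p..q, f' x = f q - f p := by
  set d := max p (min c q) with hd'
  have hpd : p ≤ d := le_max_left _ _
  have hdq : d ≤ q := max_le hpq (min_le_right _ _)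
  have hi : IntervalIntegrable f' volume p q := by
    have h1 : IntegrableOn f' (Ioc p d) := by
      refine intervalIntegral.integrableOn_deriv_of_nonneg (hf.mono (Icc_subset_Icc le_rfl hdq))
        (fun x hx => hd x ⟨hx.1, hx.2.trans_le hdq⟩ ?_) (fun x hx => hn x ⟨hx.1, hx.2.trans_le hdq⟩)
      rcases lt_max_iff.1 hx.2 with h | h
      · exact absurd h (not_lt.2 hx.1.le)
      · exact (h.trans_le (min_le_left _ _)).ne
    have h2 : IntegrableOn f' (Ioc d q) := by
      refine intervalIntegral.integrableOn_deriv_of_nonneg (hf.mono (Icc_subset_Icc hpd le_rfl))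
        (fun x hx => hd x ⟨hpd.trans_lt hx.1, hx.2⟩ ?_) (fun x hx => hn x ⟨hpd.trans_lt hx.1, hx.2⟩)
      have h := (le_max_right _ _).trans_lt hx.1
      rcases min_lt_iff.1 h with h | h
      · exact h.ne'
      · exact absurd h (not_lt.2 hx.2.le)
    exact ((intervalIntegrable_iff_integrableOn_Ioc_of_le hpd).2 h1).trans
      ((intervalIntegrable_iff_integrableOn_Ioc_of_le hdq).2 h2)
  exact ⟨hi, integral_eq_of_hasDerivAt_off_countable_of_le f f' hpq (countable_singleton c) hf
    (fun x hx => hd x hx.1 (by simpa using hx.2)) hi⟩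

theorem hasDerivAt_sqrt_sub_const {c x : ℝ} (h : x ≠ c) :
    HasDerivAt (fun u => √(u - c)) (2⁻¹ * (√(x - c))⁻¹) x := by
  have h1 := ((hasDerivAt_id x).sub_const c).sqrt (sub_ne_zero.2 h)
  convert! h1 using 1
  simp [mul_comm]

theorem hasDerivAt_sqrt_const_sub {c x : ℝ} (h : x ≠ c) :
    HasDerivAt (fun u => √(c - u)) (-(2⁻¹ * (√(c - x))⁻¹)) x := by
  have h1 := ((hasDerivAt_id x).const_sub c).sqrt (sub_ne_zero.2 h.symm)
  convert! h1 using 1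
  simp [mul_comm, neg_div]

/-- With the conventions `√x = 0` for `x ≤ 0` and `0⁻¹ = 0`, the formula holds for every position
of `a` relative to `p` and `q`. -/
theorem integral_inv_sqrt_const_sub {p q : ℝ} (hpq : p ≤ q) (a : ℝ) :
    IntervalIntegrable (fun u => (√(a - u))⁻¹) volume p q ∧
      ∫ u in p..q, (√(a - u))⁻¹ = 2 * (√(a - p) - √(a - q)) := by
  obtain ⟨h1, h2⟩ := integral_of_deriv_nonneg (f := fun u => -2 * √(a - u))
    (f' := fun u => (√(a - u))⁻¹) a hpq (by fun_prop) (fun x _ hx => by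
      convert! (hasDerivAt_sqrt_const_sub hx).const_mul (-2) using 1; ring)
      (fun x _ => by positivity)
  exact ⟨h1, by rw [h2]; ring⟩

theorem integral_inv_sqrt_sub_const {p q : ℝ} (hpq : p ≤ q) (u : ℝ) :
    IntervalIntegrable (fun b => (√(b - u))⁻¹) volume p q ∧
      ∫ b in p..q, (√(b - u))⁻¹ = 2 * (√(q - u) - √(p - u)) := by
  obtain ⟨h1, h2⟩ := integral_of_deriv_nonneg (f := fun b => 2 * √(b - u))
    (f' := fun b => (√(b - u))⁻¹) u hpq (by fun_prop) (fun x _ hx => by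
      convert! (hasDerivAt_sqrt_sub_const hx).const_mul 2 using 1; ring)
      (fun x _ => by positivity)
  exact ⟨h1, by rw [h2]; ring⟩

/-- The Abel transform of `1/√(c - u)` on `(p, c)` has a logarithmic singularity at `c`. The
primitive is `-2 log (√(a - u) + √(c - u))`, valid up to `min a c`. -/
theorem integral_inv_sqrt_mul_inv_sqrt {p a c : ℝ} (hpc : p ≤ c) (hpa : p < a) (hac : a ≠ c) :
    IntervalIntegrable (fun u => (√(a - u))⁻¹ * (√(c - u))⁻¹) volume p c ∧
      ∫ u in p..c, (√(a - u))⁻¹ * (√(c - u))⁻¹ =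
        2 * Real.log (√(a - p) + √(c - p)) - Real.log (a - c) := by
  have hd1 : p ≤ min a c := le_min hpa.le hpc
  have hd2 : min a c ≤ c := min_le_right _ _
  have hpos : ∀ u, u ≤ min a c → 0 < √(a - u) + √(c - u) := by
    intro u hu
    rcases lt_or_gt_of_ne hac with h | h
    · have : 0 < √(c - u) := Real.sqrt_pos.2 (by linarith [hu.trans (min_le_left a c)])
      positivity
    · have : 0 < √(a - u) := Real.sqrt_pos.2 (by linarith [hu.trans (min_le_right a c)])
      positivity
  obtain ⟨h1, h2⟩ := integral_of_deriv_nonneg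
    (f := fun u => -2 * Real.log (√(a - u) + √(c - u)))
    (f' := fun u => (√(a - u))⁻¹ * (√(c - u))⁻¹) c hd1
    (ContinuousOn.mul continuousOn_const (ContinuousOn.log (by fun_prop)
      fun u hu => (hpos u hu.2).ne'))
    (fun x hx _ => by
      have ha : x < a := hx.2.trans_le (min_le_left _ _)
      have hc : x < c := hx.2.trans_le (min_le_right _ _)
      have hsa : √(a - x) ≠ 0 := (Real.sqrt_pos.2 (sub_pos.2 ha)).ne'
      have hsc : √(c - x) ≠ 0 := (Real.sqrt_pos.2 (sub_pos.2 hc)).ne'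
      have hs := (hpos x hx.2.le).ne'
      convert! (((hasDerivAt_sqrt_const_sub ha.ne).add (hasDerivAt_sqrt_const_sub hc.ne)).log
        hs).const_mul (-2) using 1
      simp only [Pi.add_apply]
      field_simp
      ring)
    (fun x _ => by positivity)
  have h3 : EqOn (fun u => (√(a - u))⁻¹ * (√(c - u))⁻¹) (fun _ => 0) (uIoc (min a c) c) := by
    intro u hu
    rw [uIoc_of_le hd2] at hu
    have : a < u := by
      rcases min_lt_iff.1 hu.1 with h | h
      · exact h
      · exact absurd h (not_lt.2 hu.2)
    simp [Real.sqrt_eq_zero_of_nonpos (sub_nonpos.2 this.le)]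
  have h4 : IntervalIntegrable (fun u => (√(a - u))⁻¹ * (√(c - u))⁻¹) volume (min a c) c :=
    (intervalIntegrable_congr (f := fun _ : ℝ => (0 : ℝ)) h3.symm).1 (by simp)
  have h5 : ∫ u in (min a c)..c, (√(a - u))⁻¹ * (√(c - u))⁻¹ = 0 := by
    rw [intervalIntegral.integral_of_le hd2, ← uIoc_of_le hd2,
      setIntegral_congr_fun measurableSet_uIoc h3]
    simp
  refine ⟨h1.trans h4, ?_⟩
  rw [← intervalIntegral.integral_add_adjacent_intervals h1 h4, h2, h5]
  have e : Real.log (√(a - min a c) + √(c - min a c)) = Real.log (a - c) / 2 := by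
    rcases le_total a c with h | h
    · rw [min_eq_left h, sub_self, Real.sqrt_zero, zero_add, Real.log_sqrt (sub_nonneg.2 h),
        ← Real.log_neg_eq_log, neg_sub]
    · rw [min_eq_right h, sub_self, Real.sqrt_zero, add_zero, Real.log_sqrt (sub_nonneg.2 h)]
  rw [e]; ring

theorem integral_inv_sqrt_mul_inv_sqrt_of_le {p a c : ℝ} (hpc : p ≤ c) (hap : a ≤ p) :
    IntervalIntegrable (fun u => (√(a - u))⁻¹ * (√(c - u))⁻¹) volume p c ∧
      ∫ u in p..c, (√(a - u))⁻¹ * (√(c - u))⁻¹ = 0 := by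
  have h3 : EqOn (fun u => (√(a - u))⁻¹ * (√(c - u))⁻¹) (fun _ => 0) (uIoc p c) := by
    intro u hu
    rw [uIoc_of_le hpc] at hu
    have : a ≤ u := hap.trans hu.1.le
    simp [Real.sqrt_eq_zero_of_nonpos (sub_nonpos.2 this)]
  refine ⟨(intervalIntegrable_congr (f := fun _ : ℝ => (0 : ℝ)) h3.symm).1 (by simp), ?_⟩
  rw [intervalIntegral.integral_of_le hpc, ← uIoc_of_le hpc,
    setIntegral_congr_fun measurableSet_uIoc h3]
  simp

theorem hasDerivAt_arcsin_affine {a c x : ℝ} (hx : x ∈ Ioo a c) :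
    HasDerivAt (fun u => Real.arcsin ((2 * u - a - c) / (c - a)))
      ((√((x - a) * (c - x)))⁻¹) x := by
  have hca : 0 < c - a := by linarith [hx.1, hx.2]
  have h0 : 0 < (x - a) * (c - x) := mul_pos (sub_pos.2 hx.1) (sub_pos.2 hx.2)
  have hin : HasDerivAt (fun u => (2 * u - a - c) / (c - a)) (2 / (c - a)) x := by
    convert! ((((hasDerivAt_id x).const_mul 2).sub_const a).sub_const c).div_const (c - a) using 1
    simp
  have hne1 : (2 * x - a - c) / (c - a) ≠ -1 := by
    rw [Ne, div_eq_iff hca.ne']; intro h; linarith [hx.1]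
  have hne2 : (2 * x - a - c) / (c - a) ≠ 1 := by
    rw [Ne, div_eq_iff hca.ne']; intro h; linarith [hx.2]
  convert! (Real.hasDerivAt_arcsin hne1 hne2).comp x hin using 1
  have e : 1 - ((2 * x - a - c) / (c - a)) ^ 2 = (2 / (c - a)) ^ 2 * ((x - a) * (c - x)) := by
    field_simp; ring
  rw [e, Real.sqrt_mul (sq_nonneg _), Real.sqrt_sq (by positivity)]
  have : √((x - a) * (c - x)) ≠ 0 := (Real.sqrt_pos.2 h0).ne'
  field_simp

theorem hasDerivAt_sqrt_quadratic {a c x : ℝ} (hx : x ∈ Ioo a c) :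
    HasDerivAt (fun u => √((u - a) * (c - u))) ((a + c - 2 * x) / 2 * (√((x - a) * (c - x)))⁻¹) x := by
  have h0 : 0 < (x - a) * (c - x) := mul_pos (sub_pos.2 hx.1) (sub_pos.2 hx.2)
  convert! ((((hasDerivAt_id x).sub_const a).mul ((hasDerivAt_id x).const_sub c)).sqrt h0.ne') using 1
  simp only [id, Pi.mul_apply]
  field_simp
  ring

/-- A beta integral, with primitive
`-√((u - a)(c - u)) + (c - a)/2 · arcsin ((2u - a - c)/(c - a))`. -/
theorem integral_sqrt_mul_inv_sqrt {a c : ℝ} (hac : a ≤ c) :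
    IntervalIntegrable (fun u => √(u - a) * (√(c - u))⁻¹) volume a c ∧
      ∫ u in a..c, √(u - a) * (√(c - u))⁻¹ = Real.pi / 2 * (c - a) := by
  rcases hac.eq_or_lt with rfl | hac'
  · simp
  have hca : c - a ≠ 0 := (sub_pos.2 hac').ne'
  obtain ⟨h1, h2⟩ := integral_of_deriv_nonneg
    (f := fun u => -√((u - a) * (c - u)) +
      (c - a) / 2 * Real.arcsin ((2 * u - a - c) / (c - a)))
    (f' := fun u => √(u - a) * (√(c - u))⁻¹) a hac
    (by
      apply Continuous.continuousOn
      exact (by fun_prop : Continuous fun u => -√((u - a) * (c - u))).add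
        (continuous_const.mul (Real.continuous_arcsin.comp (by fun_prop))))
    (fun x hx _ => by
      convert! (hasDerivAt_sqrt_quadratic hx).neg.add
        ((hasDerivAt_arcsin_affine hx).const_mul ((c - a) / 2)) using 1
      have h3 : 0 < x - a := sub_pos.2 hx.1
      have h4 : √(x - a) ≠ 0 := (Real.sqrt_pos.2 h3).ne'
      have h5 : √(c - x) ≠ 0 := (Real.sqrt_pos.2 (sub_pos.2 hx.2)).ne'
      rw [Real.sqrt_mul h3.le]
      have h6 := Real.sq_sqrt h3.le
      field_simp
      linarith)
    (fun x _ => by positivity)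
  refine ⟨h1, ?_⟩
  rw [h2]
  have e1 : (2 * c - a - c) / (c - a) = 1 := by rw [div_eq_one_iff_eq hca]; ring
  have e2 : (2 * a - a - c) / (c - a) = -1 := by rw [div_eq_iff hca]; ring
  simp only [e1, e2, Real.arcsin_one, Real.arcsin_neg_one, sub_self, mul_zero, zero_mul,
    Real.sqrt_zero]
  ring

/-- The area of a half disc of diameter `u`. -/
theorem integral_sqrt_mul_sqrt {u : ℝ} (hu : 0 ≤ u) :
    ∫ a in (0 : ℝ)..u, √a * √(u - a) = Real.pi / 8 * u ^ 2 := by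
  rcases hu.eq_or_lt with rfl | hu'
  · simp
  obtain ⟨-, h2⟩ := integral_of_deriv_nonneg
    (f := fun a => (2 * a - u) / 4 * √((a - 0) * (u - a)) +
      u ^ 2 / 8 * Real.arcsin ((2 * a - 0 - u) / (u - 0)))
    (f' := fun a => √a * √(u - a)) 0 hu
    (by
      apply Continuous.continuousOn
      exact (by fun_prop : Continuous fun a => (2 * a - u) / 4 * √((a - 0) * (u - a))).add
        (continuous_const.mul (Real.continuous_arcsin.comp (by fun_prop))))
    (fun x hx _ => by
      have h0 : HasDerivAt (fun a : ℝ => (2 * a - u) / 4) (2 / 4) x := by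
        convert! (((hasDerivAt_id x).const_mul 2).sub_const u).div_const 4 using 1
        simp
      convert! (h0.mul (hasDerivAt_sqrt_quadratic hx)).add
        ((hasDerivAt_arcsin_affine hx).const_mul (u ^ 2 / 8)) using 1
      have h3 : 0 < x := hx.1
      have h3' : 0 < u - x := sub_pos.2 hx.2
      have h4 : √x ≠ 0 := (Real.sqrt_pos.2 h3).ne'
      have h5 : √(u - x) ≠ 0 := (Real.sqrt_pos.2 h3').ne'
      rw [sub_zero, Real.sqrt_mul h3.le]
      have h6 := Real.sq_sqrt h3.le
      have h7 := Real.sq_sqrt h3'.le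
      field_simp
      rw [h6, h7]
      ring)
    (fun x _ => by positivity)
  rw [h2]
  have e1 : (2 * u - 0 - u) / (u - 0) = 1 := by rw [div_eq_one_iff_eq (by simpa using hu'.ne')]; ring
  have e2 : (2 * 0 - 0 - u) / (u - 0) = -1 := by rw [div_eq_iff (by simpa using hu'.ne')]; ring
  rw [e1, e2]
  simp only [Real.arcsin_one, Real.arcsin_neg_one, sub_self, mul_zero, zero_mul,
    Real.sqrt_zero]
  ring

theorem integral_sub_mul_inv_sqrt {p c : ℝ} (hpc : p ≤ c) :
    ∫ a in p..c, (c - a) * (√(a - p))⁻¹ = 4 / 3 * ((c - p) * √(c - p)) := by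
  obtain ⟨-, h2⟩ := integral_of_deriv_nonneg
    (f := fun a => 2 * (c - p) * √(a - p) - 2 / 3 * √(a - p) ^ 3)
    (f' := fun a => (c - a) * (√(a - p))⁻¹) p hpc (by fun_prop)
    (fun x hx hne => by
      convert! ((hasDerivAt_sqrt_sub_const hne).const_mul (2 * (c - p))).sub
        (((hasDerivAt_sqrt_sub_const hne).pow 3).const_mul (2 / 3)) using 1
      have h3 : 0 < x - p := sub_pos.2 hx.1
      have h4 : √(x - p) ≠ 0 := (Real.sqrt_pos.2 h3).ne'
      have h6 := Real.sq_sqrt h3.le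
      field_simp
      push_cast
      rw [h6]; ring)
    (fun x hx => mul_nonneg (sub_nonneg.2 hx.2.le) (by positivity))
  rw [h2]
  have h6 := Real.sq_sqrt (sub_nonneg.2 hpc)
  have : √(c - p) ^ 3 = (c - p) * √(c - p) := by rw [pow_succ, h6]
  simp only [this, sub_self, Real.sqrt_zero]
  ring

theorem integral_sq_mul_inv_sqrt {p c : ℝ} (hpc : p ≤ c) :
    IntervalIntegrable (fun u => u ^ 2 * (√(c - u))⁻¹) volume p c ∧
    ∫ u in p..c, u ^ 2 * (√(c - u))⁻¹ =
      2 * (c ^ 2 * √(c - p) - 2 / 3 * c * √(c - p) ^ 3 + √(c - p) ^ 5 / 5) := by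
  obtain ⟨h1, h2⟩ := integral_of_deriv_nonneg
    (f := fun u => -2 * (c ^ 2 * √(c - u) - 2 / 3 * c * √(c - u) ^ 3 + √(c - u) ^ 5 / 5))
    (f' := fun u => u ^ 2 * (√(c - u))⁻¹) c hpc (by fun_prop)
    (fun x hx hne => by
      have h := hasDerivAt_sqrt_const_sub hne
      convert! (((h.const_mul (c ^ 2)).sub ((h.pow 3).const_mul (2 / 3 * c))).add
        ((h.pow 5).div_const 5)).const_mul (-2) using 1
      have h3 : 0 < c - x := sub_pos.2 hx.2
      have h4 : √(c - x) ≠ 0 := (Real.sqrt_pos.2 h3).ne'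
      have h6 := Real.sq_sqrt h3.le
      field_simp
      push_cast
      generalize √(c - x) = r at h6 ⊢
      have h7 : x = c - r ^ 2 := by rw [h6]; ring
      rw [h7]
      ring)
    (fun x hx => by positivity)
  refine ⟨h1, ?_⟩
  rw [h2]
  simp only [sub_self, Real.sqrt_zero]
  ring

theorem integral_sub_mul_sqrt_sub {p q c : ℝ} (hpq : p ≤ q) (hqc : q ≤ c) :
    ∫ u in p..q, (c - u) * √(c - u) = 2 / 5 * (√(c - p) ^ 5 - √(c - q) ^ 5) := by
  obtain ⟨-, h2⟩ := integral_of_deriv_nonneg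
    (f := fun u => -(2 / 5) * √(c - u) ^ 5)
    (f' := fun u => (c - u) * √(c - u)) c hpq (by fun_prop)
    (fun x hx hne => by
      have h := hasDerivAt_sqrt_const_sub hne
      convert! (h.pow 5).const_mul (-(2 / 5)) using 1
      have h3 : 0 < c - x := by linarith [hx.2]
      have h4 : √(c - x) ≠ 0 := (Real.sqrt_pos.2 h3).ne'
      have h6 := Real.sq_sqrt h3.le
      field_simp
      push_cast
      nth_rw 1 [← h6]
      ring)
    (fun x hx => mul_nonneg (by linarith [hx.2]) (Real.sqrt_nonneg _))
  rw [h2]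
  ring

theorem integral_sub_mul_sqrt {c : ℝ} (hc : 0 ≤ c) :
    ∫ a in (0 : ℝ)..c, (c - a) * √a = 4 / 15 * √c ^ 5 := by
  obtain ⟨-, h2⟩ := integral_of_deriv_nonneg
    (f := fun a => 2 / 3 * c * √a ^ 3 - 2 / 5 * √a ^ 5)
    (f' := fun a => (c - a) * √a) 0 hc (by fun_prop)
    (fun x hx hne => by
      have h := Real.hasDerivAt_sqrt hne
      convert! ((h.pow 3).const_mul (2 / 3 * c)).sub ((h.pow 5).const_mul (2 / 5)) using 1
      have h3 : 0 < x := hx.1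
      have h4 : √x ≠ 0 := (Real.sqrt_pos.2 h3).ne'
      have h6 := Real.sq_sqrt h3.le
      field_simp
      push_cast
      nth_rw 1 [← h6]
      ring)
    (fun x hx => mul_nonneg (by linarith [hx.2]) (Real.sqrt_nonneg _))
  rw [h2]
  have h6 := Real.sq_sqrt hc
  have : √c ^ 5 = c * √c ^ 3 := by rw [show √c ^ 5 = √c ^ 2 * √c ^ 3 by ring, h6]
  simp only [Real.sqrt_zero, this]
  ring

/-- The logarithmic potential at `a` of the density `1/√(b - p)` on `(p, R)`, from the substitution
`b = p + y²`. Of the last two terms, the first vanishes for `a ≤ p` and the second for `p ≤ a`. -/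
theorem integral_log_mul_inv_sqrt {p a R : ℝ} (hpR : p ≤ R) (hap : a ≠ p) (haR : a < R)
    (hi : IntervalIntegrable (fun b => Real.log |a - b| * (√(b - p))⁻¹) volume p R) :
    ∫ b in p..R, Real.log |a - b| * (√(b - p))⁻¹ =
      2 * √(R - p) * (Real.log (R - a) - 2) +
        2 * √(a - p) * (Real.log (√(R - p) + √(a - p)) - Real.log (√(R - p) - √(a - p))) +
        4 * √(p - a) * Real.arctan (√(R - p) / √(p - a)) := by
  rcases lt_or_gt_of_ne hap with h | h
  -- for `a < p` the primitive is regular, with `b - a = y² + k²`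
  · set k := √(p - a) with hk
    have hk0 : 0 < k := Real.sqrt_pos.2 (sub_pos.2 h)
    have hk2 : k ^ 2 = p - a := Real.sq_sqrt (sub_pos.2 h).le
    have hpos : ∀ b ∈ Icc p R, b - a ≠ 0 := fun b hb => by
      have := hb.1; exact (by linarith : 0 < b - a).ne'
    have h2 := integral_eq_of_hasDerivAt_off_countable_of_le
      (fun b => 2 * √(b - p) * (Real.log (b - a) - 2) + 4 * k * Real.arctan (√(b - p) / k))
      (fun b => Real.log |a - b| * (√(b - p))⁻¹) hpR (countable_singleton p)
      (((by fun_prop : Continuous fun b => 2 * √(b - p)).continuousOn.mul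
        ((ContinuousOn.log (by fun_prop) hpos).sub continuousOn_const)).add
        (by fun_prop : Continuous fun b => 4 * k * Real.arctan (√(b - p) / k)).continuousOn)
      (fun x hx => by
        have hxp : 0 < x - p := sub_pos.2 hx.1.1
        have hs := hasDerivAt_sqrt_sub_const (c := p) (sub_pos.1 hxp).ne'
        have hxa := hpos x ⟨hx.1.1.le, hx.1.2.le⟩
        have hlog : HasDerivAt (fun b => Real.log (b - a) - 2) (1 / (x - a)) x :=
          (((hasDerivAt_id x).sub_const a).log hxa).sub_const 2
        convert! ((hs.const_mul 2).mul hlog).add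
          (((hs.div_const k).arctan).const_mul (4 * k)) using 1
        rw [Real.log_abs, ← Real.log_neg_eq_log, neg_sub]
        have h4 : √(x - p) ≠ 0 := (Real.sqrt_pos.2 hxp).ne'
        have h6 := Real.sq_sqrt hxp.le
        have e : 1 + (√(x - p) / k) ^ 2 = (x - a) / k ^ 2 := by
          rw [div_pow, h6]
          field_simp
          rw [hk2]; ring
        rw [e]
        generalize Real.log (x - a) = l
        field_simp
        rw [hk2, h6]
        ring) hi
    rw [h2, Real.sqrt_eq_zero_of_nonpos (sub_neg.2 h).le]
    simp
  -- for `p < a` one has `b - a = (y + k)(y - k)`, and the primitive is continuous across `b = a`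
  · set k := √(a - p) with hk
    have hk0 : 0 < k := Real.sqrt_pos.2 (sub_pos.2 h)
    have hk2 : k ^ 2 = a - p := Real.sq_sqrt (sub_pos.2 h).le
    have hfac : ∀ b, p ≤ b → b - a = (√(b - p) + k) * (√(b - p) - k) := by
      intro b hb
      have := Real.sq_sqrt (sub_nonneg.2 hb)
      nlinarith
    have h2 := integral_eq_of_hasDerivAt_off_countable_of_le
      (fun b => 2 * ((√(b - p) + k) * Real.log (√(b - p) + k) +
        (√(b - p) - k) * Real.log (√(b - p) - k) - 2 * √(b - p)))
      (fun b => Real.log |a - b| * (√(b - p))⁻¹) hpR (countable_singleton a)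
      (by
        apply Continuous.continuousOn
        have c1 := Real.continuous_mul_log.comp (by fun_prop : Continuous fun b => √(b - p) + k)
        have c2 := Real.continuous_mul_log.comp (by fun_prop : Continuous fun b => √(b - p) - k)
        exact continuous_const.mul ((c1.add c2).sub (by fun_prop)))
      (fun x hx => by
        have hxp : 0 < x - p := sub_pos.2 hx.1.1
        have hs := hasDerivAt_sqrt_sub_const (c := p) (sub_pos.1 hxp).ne'
        have hxa : x - a ≠ 0 := sub_ne_zero.2 hx.2
        have hf := hfac x hx.1.1.le
        have n1 : √(x - p) + k ≠ 0 := fun h0 => hxa (by rw [hf, h0, zero_mul])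
        have n2 : √(x - p) - k ≠ 0 := fun h0 => hxa (by rw [hf, h0, mul_zero])
        convert! ((((Real.hasDerivAt_mul_log n1).comp x (hs.add_const k)).add
          ((Real.hasDerivAt_mul_log n2).comp x (hs.sub_const k))).sub (hs.const_mul 2)).const_mul 2
          using 1
        rw [Real.log_abs, ← Real.log_neg_eq_log, neg_sub, hf, Real.log_mul n1 n2]
        ring) hi
    rw [h2, Real.sqrt_eq_zero_of_nonpos (sub_neg.2 h).le]
    have hf := hfac R hpR
    have hRa : R - a ≠ 0 := (sub_pos.2 haR).ne'
    have n1 : √(R - p) + k ≠ 0 := fun h0 => hRa (by rw [hf, h0, zero_mul])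
    have n2 : √(R - p) - k ≠ 0 := fun h0 => hRa (by rw [hf, h0, mul_zero])
    rw [hf, Real.log_mul n1 n2]
    simp only [sub_self, Real.sqrt_zero, zero_add, zero_sub, Real.log_neg_eq_log]
    ring

/-! ### Abel transforms of neutral weights and their potentials -/

/-- The Abel transform: the superposition, with weight `m u du`, of the half-line densities
`1/√(b - u)` on `(u, ∞)`. The convention `(√x)⁻¹ = 0` for `x ≤ 0` encodes the restriction
to `u < b`. -/
noncomputable def abel (m : ℝ → ℝ) (b : ℝ) : ℝ := ∫ u, m u * (√(b - u))⁻¹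

/-- A neutral weight on `[0, L]` whose Abel transform converges absolutely, with locally square
integrable absolute value. -/
structure NeutralWeight (m : ℝ → ℝ) (L : ℝ) : Prop where
  nonneg : 0 ≤ L
  integrable : Integrable m
  neutral : ∫ u, m u = 0
  support : ∀ u, u ∉ Icc 0 L → m u = 0
  ae_integrable : ∀ᵐ b, Integrable fun u => m u * (√(b - u))⁻¹
  sq_integrable : ∀ R, IntegrableOn (fun b => (∫ u, |m u| * (√(b - u))⁻¹) ^ 2) (Ioc 0 R)

variable {m : ℝ → ℝ} {L : ℝ}

theorem NeutralWeight.aestronglyMeasurable_kernel (hm : NeutralWeight m L) (μ : Measure ℝ) [SFinite μ] :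
    AEStronglyMeasurable (fun q : ℝ × ℝ => m q.2 * (√(q.1 - q.2))⁻¹) (μ.prod volume) :=
  (hm.integrable.aestronglyMeasurable.comp_snd (μ := μ)).mul
    (Measurable.aestronglyMeasurable (by fun_prop))

theorem NeutralWeight.aestronglyMeasurable_abel (hm : NeutralWeight m L) : AEStronglyMeasurable (abel m) :=
  (hm.aestronglyMeasurable_kernel volume).integral_prod_right'

theorem NeutralWeight.abel_of_nonpos (hm : NeutralWeight m L) {b : ℝ} (hb : b ≤ 0) : abel m b = 0 := by
  unfold abel
  rw [integral_eq_zero_of_ae]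
  refine Eventually.of_forall fun u => ?_
  by_cases hu : u ∈ Icc 0 L
  · simp [Real.sqrt_eq_zero_of_nonpos (by linarith [hu.1] : b - u ≤ 0)]
  · simp [hm.support u hu]

theorem NeutralWeight.integrable_mul_kernel (hm : NeutralWeight m L) {φ : ℝ → ℝ} (hφ : Measurable φ) {R : ℝ}
    (hφ2 : IntegrableOn (fun b => φ b ^ 2) (Ioc 0 R)) :
    Integrable (Function.uncurry fun b u => φ b * (m u * (√(b - u))⁻¹))
      ((volume.restrict (Ioc 0 R)).prod volume) := by
  have hmeas : AEStronglyMeasurable (Function.uncurry fun b u => φ b * (m u * (√(b - u))⁻¹))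
      ((volume.restrict (Ioc 0 R)).prod volume) :=
    (hφ.comp measurable_fst).aestronglyMeasurable.mul (hm.aestronglyMeasurable_kernel _)
  rw [integrable_prod_iff hmeas]
  constructor
  · filter_upwards [ae_restrict_of_ae hm.ae_integrable] with b hb
    exact hb.const_mul (φ b)
  · refine (hφ2.add (hm.sq_integrable R)).mono' hmeas.norm.integral_prod_right'
      (Eventually.of_forall fun b => ?_)
    have e : ∫ u, ‖φ b * (m u * (√(b - u))⁻¹)‖ = |φ b| * ∫ u, |m u| * (√(b - u))⁻¹ := by
      rw [← integral_const_mul]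
      refine integral_congr_ae (Eventually.of_forall fun u => ?_)
      simp [abs_of_nonneg (Real.sqrt_nonneg _)]
    have h0 : 0 ≤ ∫ u, |m u| * (√(b - u))⁻¹ := integral_nonneg fun u => by positivity
    simp only [Function.uncurry, e, Pi.add_apply]
    rw [Real.norm_of_nonneg (mul_nonneg (abs_nonneg _) h0), ← sq_abs (φ b)]
    nlinarith [sq_nonneg (|φ b| - ∫ u, |m u| * (√(b - u))⁻¹), mul_nonneg (abs_nonneg (φ b)) h0]

theorem NeutralWeight.integrableOn_mul_abel (hm : NeutralWeight m L) {φ : ℝ → ℝ} (hφ : Measurable φ) {R : ℝ}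
    (hφ2 : IntegrableOn (fun b => φ b ^ 2) (Ioc 0 R)) :
    IntegrableOn (fun b => φ b * abel m b) (Ioc 0 R) := by
  have := (hm.integrable_mul_kernel hφ hφ2).integral_prod_left
  refine this.congr (Eventually.of_forall fun b => ?_)
  simp [Function.uncurry, integral_const_mul, abel]

/-- Fubini's theorem for the Abel transform on a bounded interval. -/
theorem NeutralWeight.setIntegral_mul_abel (hm : NeutralWeight m L) {φ : ℝ → ℝ} (hφ : Measurable φ) {R : ℝ}
    (hφ2 : IntegrableOn (fun b => φ b ^ 2) (Ioc 0 R)) (hR : L ≤ R) {I : ℝ → ℝ}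
    (hI : ∀ᵐ u, u ∈ Icc 0 L →
      IntervalIntegrable (fun b => φ b * (√(b - u))⁻¹) volume u R →
      ∫ b in u..R, φ b * (√(b - u))⁻¹ = I u) :
    ∫ b in Ioc 0 R, φ b * abel m b = ∫ u, m u * I u := by
  have h := hm.integrable_mul_kernel hφ hφ2
  have e : ∀ b, φ b * abel m b = ∫ u, φ b * (m u * (√(b - u))⁻¹) := fun b => by
    rw [integral_const_mul, abel]
  simp_rw [e]
  rw [integral_integral_swap h]
  refine integral_congr_ae ?_
  filter_upwards [h.prod_left_ae, hI] with u hu hIu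
  have e2 : ∀ b, φ b * (m u * (√(b - u))⁻¹) = m u * (φ b * (√(b - u))⁻¹) := fun b => by ring
  simp only [Function.uncurry, e2] at hu ⊢
  rw [integral_const_mul]
  by_cases h0 : m u = 0
  · simp [h0]
  have hu1 : u ∈ Icc 0 L := by
    by_contra hc; exact h0 (hm.support u hc)
  have hu2 : IntegrableOn (fun b => φ b * (√(b - u))⁻¹) (Ioc 0 R) := by
    refine (hu.const_mul (m u)⁻¹).congr (Eventually.of_forall fun b => ?_)
    field_simp
  have hu3 : u ≤ R := hu1.2.trans hR
  have hu4 : IntervalIntegrable (fun b => φ b * (√(b - u))⁻¹) volume u R :=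
    (intervalIntegrable_iff_integrableOn_Ioc_of_le hu3).2
      (hu2.mono_set (Ioc_subset_Ioc_left hu1.1))
  rw [← hIu hu1 hu4, intervalIntegral.integral_of_le hu3]
  congr 1
  refine setIntegral_eq_of_subset_of_forall_sdiff_eq_zero measurableSet_Ioc
    (Ioc_subset_Ioc_left hu1.1) fun b hb => ?_
  have : b ≤ u := by
    by_contra hc; exact hb.2 ⟨not_le.1 hc, hb.1.2⟩
  simp [Real.sqrt_eq_zero_of_nonpos (sub_nonpos.2 this)]

theorem sqrt_sub_sqrt_sub_le {R u : ℝ} (hR : 0 < R) (h0 : 0 ≤ u) :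
    |√(R - u) - √R| ≤ u / √R := by
  have hs : 0 < √R := Real.sqrt_pos.2 hR
  have hle : √(R - u) ≤ √R := Real.sqrt_le_sqrt (by linarith)
  rw [abs_of_nonpos (by linarith), le_div_iff₀ hs]
  rcases le_total u R with h | h
  · have h1 := Real.sq_sqrt hR.le
    have h2 := Real.sq_sqrt (sub_nonneg.2 h)
    nlinarith [Real.sqrt_nonneg (R - u)]
  · rw [Real.sqrt_eq_zero_of_nonpos (sub_nonpos.2 h)]
    nlinarith [Real.sq_sqrt hR.le]

theorem NeutralWeight.integrable_mul_of_bounded (hm : NeutralWeight m L) {g : ℝ → ℝ} (hg : Measurable g) {C : ℝ}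
    (hC : ∀ u ∈ Icc 0 L, |g u| ≤ C) : Integrable fun u => m u * g u := by
  refine (hm.integrable.norm.mul_const C).mono'
    (hm.integrable.aestronglyMeasurable.mul hg.aestronglyMeasurable)
    (Eventually.of_forall fun u => ?_)
  rw [norm_mul]
  by_cases hu : u ∈ Icc 0 L
  · exact mul_le_mul_of_nonneg_left (hC u hu) (norm_nonneg _)
  · simp [hm.support u hu]

theorem NeutralWeight.abs_integral_mul_le (hm : NeutralWeight m L) {g : ℝ → ℝ} {C : ℝ}
    (hC : ∀ u ∈ Icc 0 L, |g u| ≤ C) : |∫ u, m u * g u| ≤ (∫ u, |m u|) * C := by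
  rw [← Real.norm_eq_abs, ← integral_mul_const]
  refine norm_integral_le_of_norm_le (hm.integrable.norm.mul_const C)
    (Eventually.of_forall fun u => ?_)
  rw [norm_mul]
  by_cases hu : u ∈ Icc 0 L
  · exact mul_le_mul_of_nonneg_left (hC u hu) (norm_nonneg _)
  · simp [hm.support u hu]

/-- Neutrality of the weight gains a factor `1/R`. -/
theorem NeutralWeight.abs_integral_mul_sqrt_le (hm : NeutralWeight m L) {R : ℝ} (hR : 0 < R) :
    |∫ u, m u * √(R - u)| ≤ (∫ u, |m u|) * (L / √R) := by
  have h1 : Integrable fun u => m u * √(R - u) :=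
    hm.integrable_mul_of_bounded (by fun_prop) (C := √R) fun u hu => by
      rw [abs_of_nonneg (Real.sqrt_nonneg _)]
      exact Real.sqrt_le_sqrt (by linarith [hu.1])
  have e : ∫ u, m u * √(R - u) = ∫ u, m u * (√(R - u) - √R) := by
    simp_rw [mul_sub]
    rw [integral_sub h1 (hm.integrable.mul_const _), integral_mul_const, hm.neutral]
    simp
  rw [e]
  refine hm.abs_integral_mul_le fun u hu => (sqrt_sub_sqrt_sub_le hR hu.1).trans ?_
  gcongr
  exact hu.2

/-- Neutrality improves the decay of the Abel transform from `b^(-1/2)` to `b^(-3/2)`. -/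
theorem NeutralWeight.abs_abel_le (hm : NeutralWeight m L) {b : ℝ} (hb : 2 * L + 1 ≤ b) :
    |abel m b| ≤ (∫ u, |m u|) * (2 * L) * b ^ (-(3 / 2) : ℝ) := by
  have hL := hm.nonneg
  have hb0 : 0 < b := by linarith
  have hs : 0 < √b := Real.sqrt_pos.2 hb0
  have h1 : Integrable fun u => m u * (√(b - u))⁻¹ :=
    hm.integrable_mul_of_bounded (by fun_prop) (C := 1) fun u hu => by
      rw [abs_of_nonneg (by positivity)]
      exact inv_le_one_of_one_le₀ (Real.one_le_sqrt.2 (by linarith [hu.2]))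
  have e : abel m b = ∫ u, m u * ((√(b - u))⁻¹ - (√b)⁻¹) := by
    simp_rw [mul_sub]
    rw [integral_sub h1 (hm.integrable.mul_const _), integral_mul_const, hm.neutral, abel]
    simp
  have e3 : b ^ (-(3 / 2) : ℝ) = (√b)⁻¹ ^ 3 := by
    rw [Real.sqrt_eq_rpow, ← Real.rpow_neg hb0.le, ← Real.rpow_natCast, ← Real.rpow_mul hb0.le]
    norm_num
  rw [e, mul_assoc, e3]
  refine hm.abs_integral_mul_le fun u hu => ?_
  have hbu : 0 < b - u := by linarith [hu.2]
  have hs2 : √b / 2 ≤ √(b - u) := by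
    rw [show √b / 2 = √(b / 4) by
      rw [Real.sqrt_div hb0.le, show (4 : ℝ) = 2 ^ 2 by norm_num, Real.sqrt_sq zero_le_two]]
    exact Real.sqrt_le_sqrt (by linarith [hu.2])
  have hs3 : 0 < √(b - u) := Real.sqrt_pos.2 hbu
  have h2 := sqrt_sub_sqrt_sub_le hb0 hu.1
  have e2 : (√(b - u))⁻¹ - (√b)⁻¹ = -(√(b - u) - √b) * ((√(b - u))⁻¹ * (√b)⁻¹) := by
    field_simp; ring
  rw [e2, abs_mul, abs_neg, abs_of_nonneg (by positivity : 0 ≤ (√(b - u))⁻¹ * (√b)⁻¹)]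
  calc |√(b - u) - √b| * ((√(b - u))⁻¹ * (√b)⁻¹)
      ≤ (L / √b) * ((√b / 2)⁻¹ * (√b)⁻¹) := by
        gcongr
        exact h2.trans (by gcongr; exact hu.2)
    _ = 2 * L * (√b)⁻¹ ^ 3 := by field_simp

/-- Integrability from a bounded interval and a tail bound with exponent `5/4`, which leaves room
for a logarithm in front of `b^(-3/2)`. -/
theorem integrable_of_tail {f : ℝ → ℝ} {R C : ℝ} (hR : 1 ≤ R)
    (hf : AEStronglyMeasurable f) (h0 : ∀ b ≤ 0, f b = 0) (h1 : IntegrableOn f (Ioc 0 R))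
    (h2 : ∀ b, R < b → |f b| ≤ C * b ^ (-(5 / 4) : ℝ)) : Integrable f := by
  have i0 : IntegrableOn f (Iic 0) :=
    (integrableOn_congr_fun (μ := volume) (fun b hb => h0 b hb) measurableSet_Iic).2
      integrableOn_zero
  have i2 : IntegrableOn f (Ioi R) := by
    have := (integrableOn_Ioi_rpow_of_lt (by norm_num : (-(5 / 4) : ℝ) < -1)
      (by linarith : 0 < R)).const_mul C
    refine Integrable.mono' this hf.restrict ?_
    filter_upwards [ae_restrict_mem measurableSet_Ioi] with b hb
    exact h2 b hb
  rw [← integrableOn_univ, ← Iic_union_Ioi (a := (0 : ℝ)),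
    ← Ioc_union_Ioi_eq_Ioi (by linarith : (0 : ℝ) ≤ R)]
  exact i0.union (h1.union i2)

theorem abs_abel_le_abs (m : ℝ → ℝ) (b : ℝ) : |abel m b| ≤ ∫ u, |m u| * (√(b - u))⁻¹ := by
  refine (norm_integral_le_integral_norm (μ := volume) fun u => m u * (√(b - u))⁻¹).trans_eq ?_
  refine integral_congr_ae (Eventually.of_forall fun u => ?_)
  simp [abs_of_nonneg (Real.sqrt_nonneg _)]

theorem NeutralWeight.integrable_abel_sq (hm : NeutralWeight m L) : Integrable fun b => abel m b ^ 2 := by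
  have hL := hm.nonneg
  refine integrable_of_tail (R := 2 * L + 1) (C := ((∫ u, |m u|) * (2 * L)) ^ 2) (by linarith)
    (hm.aestronglyMeasurable_abel.pow 2) (fun b hb => by simp [hm.abel_of_nonpos hb]) ?_ ?_
  · refine (hm.sq_integrable _).mono' (hm.aestronglyMeasurable_abel.pow 2).restrict
      (Eventually.of_forall fun b => ?_)
    rw [Real.norm_of_nonneg (sq_nonneg _), ← sq_abs (abel m b)]
    gcongr
    exact abs_abel_le_abs m b
  · intro b hb
    have hb1 : 1 ≤ b := by linarith
    rw [abs_of_nonneg (sq_nonneg _), ← sq_abs]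
    calc |abel m b| ^ 2 ≤ ((∫ u, |m u|) * (2 * L) * b ^ (-(3 / 2) : ℝ)) ^ 2 := by
          gcongr; exact hm.abs_abel_le hb.le
      _ = ((∫ u, |m u|) * (2 * L)) ^ 2 * b ^ (-3 : ℝ) := by
          rw [mul_pow, ← Real.rpow_natCast (b ^ _), ← Real.rpow_mul (by linarith)]; norm_num
      _ ≤ _ := by
          gcongr ?_ * ?_
          exact Real.rpow_le_rpow_of_exponent_le hb1 (by norm_num)

theorem NeutralWeight.logMoment_abel (hm : NeutralWeight m L) : LogMoment (abel m) := by
  have hL := hm.nonneg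
  have hC : 0 ≤ (∫ u, |m u|) * (2 * L) :=
    mul_nonneg (integral_nonneg fun _ => abs_nonneg _) (by linarith)
  constructor
  · refine integrable_of_tail (R := 2 * L + 1) (C := (∫ u, |m u|) * (2 * L)) (by linarith)
      hm.aestronglyMeasurable_abel (fun b hb => hm.abel_of_nonpos hb) ?_ ?_
    · have := hm.integrableOn_mul_abel (φ := fun _ => 1) measurable_const (R := 2 * L + 1)
        (by simp)
      simpa using this
    · intro b hb
      refine (hm.abs_abel_le hb.le).trans ?_
      gcongr ?_ * ?_
      exact Real.rpow_le_rpow_of_exponent_le (by linarith) (by norm_num)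
  · refine integrable_of_tail (R := 2 * L + 1) (C := 8 * ((∫ u, |m u|) * (2 * L))) (by linarith)
      ((Measurable.aestronglyMeasurable (by fun_prop)).mul hm.aestronglyMeasurable_abel)
      (fun b hb => by simp [hm.abel_of_nonpos hb]) ?_ ?_
    · refine hm.integrableOn_mul_abel (by fun_prop) ?_
      have : ContinuousOn (fun b : ℝ => Real.log (1 + |b|) ^ 2) (Icc 0 (2 * L + 1)) :=
        (ContinuousOn.log (by fun_prop) fun b _ => by positivity).pow 2
      exact this.integrableOn_Icc.mono_set Ioc_subset_Icc_self
    · intro b hb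
      have hb1 : 1 ≤ b := by linarith
      have hb0 : 0 < b := by linarith
      have hl : |Real.log (1 + |b|)| ≤ 8 * b ^ (1 / 4 : ℝ) := by
        rw [abs_of_nonneg (Real.log_nonneg (by linarith [abs_nonneg b])), abs_of_pos hb0]
        have h1 := Real.log_le_rpow_div (by linarith : 0 ≤ 1 + b) (by norm_num : (0 : ℝ) < 1 / 4)
        have h2 : (1 + b) ^ (1 / 4 : ℝ) ≤ (16 * b) ^ (1 / 4 : ℝ) :=
          Real.rpow_le_rpow (by linarith) (by linarith) (by norm_num)
        have h3 : (16 * b) ^ (1 / 4 : ℝ) = 2 * b ^ (1 / 4 : ℝ) := by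
          rw [Real.mul_rpow (by norm_num) hb0.le, show (16 : ℝ) = 2 ^ (4 : ℝ) by norm_num,
            ← Real.rpow_mul zero_le_two]
          norm_num
        linarith
      rw [abs_mul]
      calc |Real.log (1 + |b|)| * |abel m b|
          ≤ 8 * b ^ (1 / 4 : ℝ) * ((∫ u, |m u|) * (2 * L) * b ^ (-(3 / 2) : ℝ)) := by
            gcongr; exact hm.abs_abel_le hb.le
        _ = 8 * ((∫ u, |m u|) * (2 * L)) * (b ^ (1 / 4 : ℝ) * b ^ (-(3 / 2) : ℝ)) := by ring
        _ = _ := by rw [← Real.rpow_add hb0]; norm_num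

theorem tendsto_setIntegral {f : ℝ → ℝ} (hf : Integrable f) (h0 : ∀ b ≤ 0, f b = 0) :
    Tendsto (fun R => ∫ b in Ioc 0 R, f b) atTop (𝓝 (∫ b, f b)) := by
  have h1 := intervalIntegral_tendsto_integral_Ioi 0 hf.integrableOn tendsto_id
  have e : ∫ b in Ioi (0 : ℝ), f b = ∫ b, f b :=
    setIntegral_eq_integral_of_forall_compl_eq_zero fun b hb => h0 b (not_lt.1 hb)
  rw [e] at h1
  refine h1.congr' ?_
  filter_upwards [eventually_ge_atTop 0] with R hR
  exact intervalIntegral.integral_of_le hR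

theorem NeutralWeight.tendsto_integral_mul_sqrt (hm : NeutralWeight m L) {ψ : ℝ → ℝ}
    (hψ : Tendsto (fun R => ψ R / √R) atTop (𝓝 0)) :
    Tendsto (fun R => (∫ u, m u * √(R - u)) * ψ R) atTop (𝓝 0) := by
  have h1 : Tendsto (fun R => (∫ u, |m u|) * L * |ψ R / √R|) atTop (𝓝 0) := by
    simpa using hψ.abs.const_mul ((∫ u, |m u|) * L)
  refine squeeze_zero_norm' ?_ h1
  filter_upwards [eventually_gt_atTop 0] with R hR
  rw [norm_mul, Real.norm_eq_abs, Real.norm_eq_abs]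
  calc _ ≤ (∫ u, |m u|) * (L / √R) * |ψ R| := by
        gcongr; exact hm.abs_integral_mul_sqrt_le hR
    _ = _ := by rw [abs_div, abs_of_nonneg (Real.sqrt_nonneg R)]; ring

theorem NeutralWeight.integral_abel (hm : NeutralWeight m L) : ∫ b, abel m b = 0 := by
  have h1 := tendsto_setIntegral hm.logMoment_abel.integrable fun b hb => hm.abel_of_nonpos hb
  refine tendsto_nhds_unique h1 ?_
  have h2 : Tendsto (fun R => (∫ u, m u * √(R - u)) * 2) atTop (𝓝 0) :=
    hm.tendsto_integral_mul_sqrt (ψ := fun _ => 2)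
      (tendsto_const_nhds.div_atTop Real.tendsto_sqrt_atTop)
  refine h2.congr' ?_
  filter_upwards [eventually_ge_atTop L] with R hR
  have h3 := hm.setIntegral_mul_abel (φ := fun _ => 1) measurable_const (R := R) (by simp) hR
    (I := fun u => 2 * √(R - u)) (Eventually.of_forall fun u hu _ => by
      simp only [one_mul]
      rw [(integral_inv_sqrt_sub_const (hu.2.trans hR) u).2]; simp)
  simp only [one_mul] at h3
  rw [h3, ← integral_mul_const]
  congr 1; funext u; ring

/-- The part of the potential on `(u, R)` of `1/√(b - u)` that stays bounded as `R → ∞`. -/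
noncomputable def potentialRemainder (a R u : ℝ) : ℝ :=
  2 * √(a - u) * (Real.log (√(R - u) + √(a - u)) - Real.log (√(R - u) - √(a - u))) +
    4 * √(u - a) * Real.arctan (√(R - u) / √(u - a))

theorem abs_log_diff_le {k y : ℝ} (hk : 0 ≤ k) (hy : 2 * k + 1 ≤ y) :
    |Real.log (y + k) - Real.log (y - k)| ≤ 4 * k / y := by
  have h1 : 0 < y - k := by linarith
  have h2 : 0 < y + k := by linarith
  have hy0 : 0 < y := by linarith
  rw [abs_of_nonneg (sub_nonneg.2 (Real.log_le_log h1 (by linarith))),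
    ← Real.log_div h2.ne' h1.ne']
  refine (Real.log_le_sub_one_of_pos (by positivity)).trans ?_
  rw [div_sub_one h1.ne', div_le_div_iff₀ h1 hy0]
  nlinarith

theorem tendsto_potentialRemainder (a u : ℝ) :
    Tendsto (fun R => potentialRemainder a R u) atTop (𝓝 (2 * Real.pi * √(u - a))) := by
  have hy : Tendsto (fun R => √(R - u)) atTop atTop :=
    Real.tendsto_sqrt_atTop.comp (tendsto_atTop_add_const_right _ (-u) tendsto_id)
  have h1 : Tendsto (fun R => Real.log (√(R - u) + √(a - u)) - Real.log (√(R - u) - √(a - u)))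
      atTop (𝓝 0) := by
    have h2 : Tendsto (fun R => 4 * √(a - u) / √(R - u)) atTop (𝓝 0) :=
      tendsto_const_nhds.div_atTop hy
    refine squeeze_zero_norm' ?_ h2
    filter_upwards [hy.eventually_ge_atTop (2 * √(a - u) + 1)] with R hR
    exact abs_log_diff_le (Real.sqrt_nonneg _) hR
  have h3 : Tendsto (fun R => 4 * √(u - a) * Real.arctan (√(R - u) / √(u - a))) atTop
      (𝓝 (2 * Real.pi * √(u - a))) := by
    rcases (Real.sqrt_nonneg (u - a)).eq_or_lt with h | h
    · simp [← h]
    · have h4 := (Real.tendsto_arctan_atTop.mono_right nhdsWithin_le_nhds).comp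
        (hy.atTop_div_const h)
      convert! h4.const_mul (4 * √(u - a)) using 2
      ring
  simpa [potentialRemainder] using (h1.const_mul (2 * √(a - u))).add h3

theorem abs_potentialRemainder_le {a R u : ℝ} (hu : u ∈ Icc 0 L)
    (hR : 2 * √|a| + 1 ≤ √(R - L)) :
    |potentialRemainder a R u| ≤ 8 * √|a| + 2 * Real.pi * √(L + |a|) := by
  have hk : √(a - u) ≤ √|a| := Real.sqrt_le_sqrt (by linarith [le_abs_self a, hu.1])
  have hk0 := Real.sqrt_nonneg (a - u)
  have hy : √(R - L) ≤ √(R - u) := Real.sqrt_le_sqrt (by linarith [hu.2])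
  have hl := abs_log_diff_le hk0 (by linarith : 2 * √(a - u) + 1 ≤ √(R - u))
  have hl2 : 4 * √(a - u) / √(R - u) ≤ 4 := by
    rw [div_le_iff₀ (by linarith)]; linarith
  have h1 : √(u - a) ≤ √(L + |a|) := Real.sqrt_le_sqrt (by linarith [neg_abs_le a, hu.2])
  have h2 : |Real.arctan (√(R - u) / √(u - a))| ≤ Real.pi / 2 :=
    abs_le.2 ⟨(Real.neg_pi_div_two_lt_arctan _).le, (Real.arctan_lt_pi_div_two _).le⟩
  refine (abs_add_le _ _).trans ?_
  rw [abs_mul, abs_mul (4 * √(u - a)), abs_of_nonneg (by positivity : 0 ≤ 2 * √(a - u)),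
    abs_of_nonneg (by positivity : 0 ≤ 4 * √(u - a))]
  calc _ ≤ 2 * √|a| * 4 + 4 * √(L + |a|) * (Real.pi / 2) := by
        gcongr; exact hl.trans hl2
    _ = _ := by ring

/-- The logarithmic potential of the Abel transform of a neutral weight. On a bounded interval
`(0, R)` it is explicit; the divergent part carries the factor `∫ m(u) √(R - u) du = O(1/√R)`. -/
theorem NeutralWeight.integral_log_mul_abel (hm : NeutralWeight m L) (a : ℝ) :
    ∫ b, Real.log |a - b| * abel m b = ∫ u, m u * (2 * Real.pi * √(u - a)) := by
  have h1 := tendsto_setIntegral (hm.logMoment_abel.integrable_log_sub_mul hm.integrable_abel_sq a)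
    fun b hb => by simp [hm.abel_of_nonpos hb]
  refine tendsto_nhds_unique h1 ?_
  -- the divergent part grows like `log R`, which is negligible against `√R`
  have hψ : Tendsto (fun R => (2 * (Real.log (R - a) - 2)) / √R) atTop (𝓝 0) := by
    have hq : Tendsto (fun R : ℝ => R - a) atTop atTop :=
      tendsto_atTop_add_const_right _ (-a) tendsto_id
    have hlog : Tendsto (fun R : ℝ => Real.log (R - a) / √(R - a)) atTop (𝓝 0) := by
      have h := (isLittleO_log_rpow_atTop (by norm_num : (0 : ℝ) < 1 / 2)).tendsto_div_nhds_zero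
      refine (h.comp hq).congr fun R => ?_
      simp [Real.sqrt_eq_rpow]
    have hrat : Tendsto (fun R : ℝ => √((R - a) / R)) atTop (𝓝 1) := by
      have : Tendsto (fun R : ℝ => 1 - a * R⁻¹) atTop (𝓝 (1 - a * 0)) :=
        tendsto_const_nhds.sub (tendsto_inv_atTop_zero.const_mul a)
      have h2 := (Real.continuous_sqrt.tendsto _).comp this
      simp only [mul_zero, sub_zero, Real.sqrt_one] at h2
      refine h2.congr' ?_
      filter_upwards [eventually_gt_atTop 0] with R hR
      simp only [Function.comp]
      congr 1; field_simp
    have h3 := ((hlog.mul hrat).const_mul 2).sub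
      ((tendsto_const_nhds (x := (4 : ℝ))).div_atTop Real.tendsto_sqrt_atTop)
    simp only [zero_mul, mul_zero, sub_zero] at h3
    refine h3.congr' ?_
    filter_upwards [eventually_gt_atTop 0, eventually_gt_atTop a] with R hR hRa
    have hs1 : √(R - a) ≠ 0 := (Real.sqrt_pos.2 (sub_pos.2 hRa)).ne'
    have hs2 : √R ≠ 0 := (Real.sqrt_pos.2 hR).ne'
    rw [Real.sqrt_div (sub_pos.2 hRa).le]
    field_simp
    ring
  have hmeas : ∀ R, Measurable (potentialRemainder a R) := fun R => by
    unfold potentialRemainder; fun_prop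
  have hev : ∀ᶠ R in atTop, 2 * √|a| + 1 ≤ √(R - L) :=
    (Real.tendsto_sqrt_atTop.comp
      (tendsto_atTop_add_const_right _ (-L) tendsto_id)).eventually_ge_atTop _
  have hrem : Tendsto (fun R => ∫ u, m u * potentialRemainder a R u) atTop
      (𝓝 (∫ u, m u * (2 * Real.pi * √(u - a)))) := by
    refine tendsto_integral_filter_of_dominated_convergence
      (fun u => ‖m u‖ * (8 * √|a| + 2 * Real.pi * √(L + |a|)))
      (Eventually.of_forall fun R =>
        hm.integrable.aestronglyMeasurable.mul (hmeas R).aestronglyMeasurable) ?_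
      (hm.integrable.norm.mul_const _)
      (Eventually.of_forall fun u => (tendsto_potentialRemainder a u).const_mul (m u))
    filter_upwards [hev] with R hR
    refine Eventually.of_forall fun u => ?_
    rw [norm_mul]
    by_cases hu : u ∈ Icc 0 L
    · exact mul_le_mul_of_nonneg_left (abs_potentialRemainder_le hu hR) (norm_nonneg _)
    · simp [hm.support u hu]
  have htot := (hm.tendsto_integral_mul_sqrt hψ).add hrem
  rw [zero_add] at htot
  refine htot.congr' ?_
  filter_upwards [eventually_ge_atTop L, eventually_gt_atTop a, hev, eventually_gt_atTop 0]
    with R hR hRa hR2 hR0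
  have hsq : IntegrableOn (fun b => Real.log |a - b| ^ 2) (Ioc 0 R) := by
    have := (intervalIntegrable_log_sq (a - 0) (a - R)).comp_sub_left a
    simp only [sub_sub_cancel] at this
    rw [intervalIntegrable_iff_integrableOn_Ioc_of_le hR0.le] at this
    simpa [Real.log_abs] using this
  rw [hm.setIntegral_mul_abel (φ := fun b => Real.log |a - b|) (by fun_prop) hsq hR
    (I := fun u => √(R - u) * (2 * (Real.log (R - a) - 2)) + potentialRemainder a R u)]
  · have i1 : Integrable fun u => m u * (√(R - u) * (2 * (Real.log (R - a) - 2))) :=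
      hm.integrable_mul_of_bounded (by fun_prop) (C := √R * |2 * (Real.log (R - a) - 2)|)
        fun u hu => by
          rw [abs_mul, abs_of_nonneg (Real.sqrt_nonneg _)]
          gcongr
          linarith [hu.1]
    have i2 : Integrable fun u => m u * potentialRemainder a R u :=
      hm.integrable_mul_of_bounded (hmeas R) fun u hu => abs_potentialRemainder_le hu hR2
    simp_rw [mul_add]
    rw [integral_add i1 i2, ← integral_mul_const]
    simp_rw [← mul_assoc]
  · have hne : ∀ᵐ u : ℝ, u ≠ a := by
      rw [ae_iff]; simp
    filter_upwards [hne] with u hua hu hi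
    rw [integral_log_mul_inv_sqrt (hu.2.trans hR) hua.symm hRa hi, potentialRemainder]
    ring

/-! ### The optimal density and the Euler–Lagrange relations -/

/-- The weight equal to `κ` on `(0, p]` and to `l/√(c - u)` on `(p, c]`. -/
noncomputable def twoPiece (κ l p c u : ℝ) : ℝ :=
  (Ioc 0 p).indicator (fun _ => κ) u + (Ioc p c).indicator (fun u => l * (√(c - u))⁻¹) u

theorem integral_twoPiece_mul {κ l p c : ℝ} (hp : 0 ≤ p) (hpc : p ≤ c) {g : ℝ → ℝ}
    (h1 : IntervalIntegrable g volume 0 p)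
    (h2 : IntervalIntegrable (fun u => g u * (√(c - u))⁻¹) volume p c) :
    Integrable (fun u => twoPiece κ l p c u * g u) ∧
      ∫ u, twoPiece κ l p c u * g u =
        κ * (∫ u in 0..p, g u) + l * ∫ u in p..c, g u * (√(c - u))⁻¹ := by
  have e : (fun u => twoPiece κ l p c u * g u) = fun u =>
      (Ioc 0 p).indicator (fun u => κ * g u) u +
        (Ioc p c).indicator (fun u => l * (g u * (√(c - u))⁻¹)) u := by
    funext u
    simp only [twoPiece, indicator_apply]
    split_ifs <;> ring
  have i1 := (integrable_indicator_iff measurableSet_Ioc).2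
    (((intervalIntegrable_iff_integrableOn_Ioc_of_le hp).1 h1).const_mul κ)
  have i2 := (integrable_indicator_iff measurableSet_Ioc).2
    (((intervalIntegrable_iff_integrableOn_Ioc_of_le hpc).1 h2).const_mul l)
  rw [e]
  refine ⟨i1.add i2, ?_⟩
  rw [integral_add i1 i2, integral_indicator measurableSet_Ioc, integral_indicator measurableSet_Ioc,
    integral_const_mul, integral_const_mul, intervalIntegral.integral_of_le hp,
    intervalIntegral.integral_of_le hpc]

theorem abs_twoPiece {κ l p c : ℝ} (hl : 0 ≤ l) (u : ℝ) :
    |twoPiece κ l p c u| = twoPiece |κ| l p c u := by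
  simp only [twoPiece, indicator_apply, mem_Ioc]
  split_ifs with h1 h2
  · exact absurd h1.2 (not_le.2 h2.1)
  · simp
  · simp [abs_of_nonneg hl, abs_of_nonneg (Real.sqrt_nonneg _)]
  · simp

/-- The Abel transform of `1/√(c - u)` on `(p, c]`. -/
noncomputable def logProfile (p c b : ℝ) : ℝ := ∫ u in p..c, (√(b - u))⁻¹ * (√(c - u))⁻¹

theorem intervalIntegrable_logProfile {p c b : ℝ} (hpc : p ≤ c) (hb : b ≠ c) :
    IntervalIntegrable (fun u => (√(b - u))⁻¹ * (√(c - u))⁻¹) volume p c := by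
  rcases le_or_gt b p with h | h
  · exact (integral_inv_sqrt_mul_inv_sqrt_of_le hpc h).1
  · exact (integral_inv_sqrt_mul_inv_sqrt hpc h hb).1

theorem abel_twoPiece {κ l p c b : ℝ} (hp : 0 ≤ p) (hpc : p ≤ c) (hb : b ≠ c) :
    Integrable (fun u => twoPiece κ l p c u * (√(b - u))⁻¹) ∧
      ∫ u, twoPiece κ l p c u * (√(b - u))⁻¹ =
        κ * (2 * (√b - √(b - p))) + l * logProfile p c b := by
  obtain ⟨h1, h2⟩ := integral_inv_sqrt_const_sub hp b
  have h3 := integral_twoPiece_mul (κ := κ) (l := l) hp hpc h1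
    (intervalIntegrable_logProfile hpc hb)
  refine ⟨h3.1, h3.2.trans ?_⟩
  rw [h2, sub_zero]
  rfl

theorem logProfile_sq_le {p c b : ℝ} (hpc : p ≤ c) (hb : b ≠ c) :
    logProfile p c b ^ 2 ≤
      2 * ((2 * Real.log (√(b - p) + √(c - p))) ^ 2 + Real.log (b - c) ^ 2) := by
  rcases le_or_gt b p with h | h
  · rw [logProfile, (integral_inv_sqrt_mul_inv_sqrt_of_le hpc h).2, zero_pow two_ne_zero]
    positivity
  · rw [logProfile, (integral_inv_sqrt_mul_inv_sqrt hpc h hb).2]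
    nlinarith [sq_nonneg (2 * Real.log (√(b - p) + √(c - p)) + Real.log (b - c))]

theorem ae_ne (c : ℝ) : ∀ᵐ b : ℝ, b ≠ c := by
  rw [ae_iff]; simp

theorem measurable_logProfile {p c : ℝ} (hpc : p ≤ c) : AEStronglyMeasurable (logProfile p c) := by
  have : AEStronglyMeasurable (fun q : ℝ × ℝ => (√(q.1 - q.2))⁻¹ * (√(c - q.2))⁻¹)
      ((volume : Measure ℝ).prod (volume.restrict (Ioc p c))) :=
    Measurable.aestronglyMeasurable (by fun_prop)
  refine this.integral_prod_right'.congr (Eventually.of_forall fun b => ?_)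
  rw [logProfile, intervalIntegral.integral_of_le hpc]

/-- The logarithmic singularity of the profile at `c` is square integrable. -/
theorem logProfile_sq_integrable {p c : ℝ} (hpc : p ≤ c) (R : ℝ) :
    IntegrableOn (fun b => logProfile p c b ^ 2) (Ioc 0 R) := by
  rcases hpc.eq_or_lt with rfl | h
  · simp [logProfile]
  rcases le_total R 0 with hR | hR
  · simp [Ioc_eq_empty_of_le hR]
  have i1 : IntegrableOn (fun b => (2 * Real.log (√(b - p) + √(c - p))) ^ 2) (Ioc 0 R) := by
    have : ContinuousOn (fun b => (2 * Real.log (√(b - p) + √(c - p))) ^ 2) (Icc 0 R) := by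
      refine ContinuousOn.pow (continuousOn_const.mul (ContinuousOn.log (by fun_prop) ?_)) 2
      intro b _
      have : 0 < √(c - p) := Real.sqrt_pos.2 (sub_pos.2 h)
      positivity
    exact this.integrableOn_Icc.mono_set Ioc_subset_Icc_self
  have i2 : IntegrableOn (fun b => Real.log (b - c) ^ 2) (Ioc 0 R) := by
    have := (intervalIntegrable_log_sq (0 - c) (R - c)).comp_sub_right c
    simp only [sub_add_cancel] at this
    rwa [intervalIntegrable_iff_integrableOn_Ioc_of_le hR] at this
  refine ((i1.add i2).const_mul 2).mono' ((measurable_logProfile hpc).pow 2).restrict ?_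
  filter_upwards [ae_restrict_of_ae (ae_ne c)] with b hb
  rw [Real.norm_of_nonneg (sq_nonneg _)]
  exact logProfile_sq_le hpc hb

/-- The weight whose Abel transform is the charge of the optimal density. -/
noncomputable def edgeWeight (A p c : ℝ) : ℝ → ℝ :=
  twoPiece (-(1 / (2 * Real.pi))) (A / (2 * Real.pi ^ 2)) p c

/-- The relation between the slope `A`, the left edge `p` and the position `c` of the wall that
makes the edge weight neutral. -/
structure EdgeRelation (A p c : ℝ) : Prop where
  slope_nonneg : 0 ≤ A
  edge_nonneg : 0 ≤ p
  edge_le : p ≤ c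
  neutral : A * √(c - p) = Real.pi * p / 2

variable {A p c : ℝ}

theorem EdgeRelation.neutralWeight (h : EdgeRelation A p c) :
    NeutralWeight (edgeWeight A p c) c := by
  have hp := h.edge_nonneg
  have hpc := h.edge_le
  have hl : 0 ≤ A / (2 * Real.pi ^ 2) := div_nonneg h.slope_nonneg (by positivity)
  have h1 := integral_inv_sqrt_const_sub hpc c
  have hone : IntervalIntegrable (fun u => (fun _ : ℝ => (1 : ℝ)) u * (√(c - u))⁻¹) volume p c := by
    simpa using h1.1
  have h2 := integral_twoPiece_mul (κ := -(1 / (2 * Real.pi))) (l := A / (2 * Real.pi ^ 2)) hp hpc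
    (g := fun _ => 1) (by simp) hone
  refine ⟨hp.trans hpc, by simpa [edgeWeight] using h2.1, ?_, ?_, ?_, ?_⟩
  · have h3 := h2.2
    simp only [mul_one, one_mul, h1.2, intervalIntegral.integral_const, sub_self, Real.sqrt_zero,
      sub_zero, smul_eq_mul] at h3
    rw [edgeWeight, h3]
    have h4 := h.neutral
    have hpi := Real.pi_ne_zero
    field_simp
    linear_combination 2 * h4
  · intro u hu
    have h3 : u ∉ Ioc 0 p := fun hm => hu ⟨hm.1.le, hm.2.trans hpc⟩
    have h4 : u ∉ Ioc p c := fun hm => hu ⟨hp.trans hm.1.le, hm.2⟩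
    simp [edgeWeight, twoPiece, indicator_of_notMem h3, indicator_of_notMem h4]
  · filter_upwards [ae_ne c] with b hb
    exact (abel_twoPiece hp hpc hb).1
  · intro R
    have hm : AEStronglyMeasurable (fun b => ∫ u, |edgeWeight A p c u| * (√(b - u))⁻¹) volume := by
      have h3 : AEStronglyMeasurable (edgeWeight A p c) := by
        simpa [edgeWeight] using h2.1.aestronglyMeasurable
      have : AEStronglyMeasurable (fun q : ℝ × ℝ => |edgeWeight A p c q.2| * (√(q.1 - q.2))⁻¹)
          ((volume : Measure ℝ).prod volume) :=
        (h3.norm.comp_snd (μ := volume)).mul (Measurable.aestronglyMeasurable (by fun_prop))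
      exact this.integral_prod_right'
    have i1 : IntegrableOn (fun b => (|-(1 / (2 * Real.pi))| * (2 * (√b - √(b - p)))) ^ 2)
        (Ioc 0 R) :=
      (by fun_prop : Continuous fun b => (|-(1 / (2 * Real.pi))| * (2 * (√b - √(b - p)))) ^ 2)
        |>.integrableOn_Icc.mono_set Ioc_subset_Icc_self
    have i2 := (logProfile_sq_integrable hpc R).const_mul ((A / (2 * Real.pi ^ 2)) ^ 2)
    -- `(x + y)² ≤ 2 (x² + y²)`
    refine ((i1.add i2).const_mul 2).mono' (hm.pow 2).restrict ?_
    filter_upwards [ae_restrict_of_ae (ae_ne c)] with b hb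
    rw [Real.norm_of_nonneg (sq_nonneg _)]
    simp only [edgeWeight, abs_twoPiece hl, (abel_twoPiece hp hpc hb).2, Pi.add_apply]
    nlinarith [sq_nonneg (|-(1 / (2 * Real.pi))| * (2 * (√b - √(b - p))) -
      A / (2 * Real.pi ^ 2) * logProfile p c b)]

/-- The density `μ_*` with a free left edge `p` and wall position `c`. -/
noncomputable def edgeDensity (A p c a : ℝ) : ℝ :=
  if p < a then
    1 / Real.pi * √(a - p) + A / (2 * Real.pi ^ 2) *
      Real.log |(√(a - p) + √(c - p)) / (√(a - p) - √(c - p))|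
  else 0

theorem logProfile_eq {a : ℝ} (hpc : p ≤ c) (hpa : p < a) (hac : a ≠ c) :
    logProfile p c a = Real.log |(√(a - p) + √(c - p)) / (√(a - p) - √(c - p))| := by
  rw [logProfile, (integral_inv_sqrt_mul_inv_sqrt hpc hpa hac).2, Real.log_abs]
  have h1 := Real.sq_sqrt (sub_pos.2 hpa).le
  have h2 := Real.sq_sqrt (sub_nonneg.2 hpc)
  have hf : a - c = (√(a - p) + √(c - p)) * (√(a - p) - √(c - p)) := by nlinarith
  have hne : a - c ≠ 0 := sub_ne_zero.2 hac
  have n1 : √(a - p) + √(c - p) ≠ 0 := fun h => hne (by rw [hf, h, zero_mul])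
  have n2 : √(a - p) - √(c - p) ≠ 0 := fun h => hne (by rw [hf, h, mul_zero])
  rw [hf, Real.log_mul n1 n2, Real.log_div n1 n2]
  ring

theorem airyDensity_eq (a : ℝ) : airyDensity a = √a / Real.pi := by
  unfold airyDensity
  split_ifs with h
  · rfl
  · simp [Real.sqrt_eq_zero_of_nonpos (not_lt.1 h)]

/-- The excluded point is the wall, where the density takes a junk value. -/
theorem charge_edgeDensity (h : EdgeRelation A p c) {a : ℝ} (hac : a ≠ c) :
    charge (edgeDensity A p c) a = abel (edgeWeight A p c) a := by
  rw [abel, edgeWeight, (abel_twoPiece h.edge_nonneg h.edge_le hac).2, charge, airyDensity_eq,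
    edgeDensity]
  have hpi := Real.pi_ne_zero
  split_ifs with hpa
  · rw [logProfile_eq h.edge_le hpa hac]
    field_simp
    ring
  · have hap := not_lt.1 hpa
    rw [logProfile, (integral_inv_sqrt_mul_inv_sqrt_of_le h.edge_le hap).2,
      Real.sqrt_eq_zero_of_nonpos (sub_nonpos.2 hap)]
    field_simp
    ring

theorem edgeDensity_of_le {a : ℝ} (h : a ≤ p) : edgeDensity A p c a = 0 :=
  if_neg (not_lt.2 h)

theorem edgeDensity_pos (hA : 0 ≤ A) {a : ℝ} (h : p < a) : 0 < edgeDensity A p c a := by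
  rw [edgeDensity, if_pos h]
  have h1 : 0 < √(a - p) := Real.sqrt_pos.2 (sub_pos.2 h)
  have h2 : 0 ≤ √(c - p) := Real.sqrt_nonneg _
  refine add_pos_of_pos_of_nonneg (mul_pos (by positivity) h1) (mul_nonneg (by positivity) ?_)
  by_cases h0 : √(a - p) - √(c - p) = 0
  · simp [h0]
  · apply Real.log_nonneg
    rw [abs_div, one_le_div (abs_pos.2 h0), abs_of_pos (by positivity : 0 < √(a - p) + √(c - p))]
    exact abs_le.2 ⟨by linarith, by linarith⟩

theorem edgeDensity_nonneg (hA : 0 ≤ A) (a : ℝ) : 0 ≤ edgeDensity A p c a := by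
  rcases le_or_gt a p with h | h
  · rw [edgeDensity_of_le h]
  · exact (edgeDensity_pos hA h).le

/-- The logarithmic potential of the charge of the optimal density. -/
noncomputable def edgePotential (A p c a : ℝ) : ℝ :=
  ∫ u, edgeWeight A p c u * (2 * Real.pi * √(u - a))

theorem edgePotential_eq (h : EdgeRelation A p c) (a : ℝ) :
    edgePotential A p c a =
      -(∫ u in 0..p, √(u - a)) + A / Real.pi * ∫ u in p..c, √(u - a) * (√(c - u))⁻¹ := by
  have h1 := integral_twoPiece_mul (κ := -(1 / (2 * Real.pi))) (l := A / (2 * Real.pi ^ 2))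
    h.edge_nonneg h.edge_le (g := fun u => 2 * Real.pi * √(u - a))
    ((by fun_prop : Continuous fun u => 2 * Real.pi * √(u - a)).intervalIntegrable _ _)
    ((integral_inv_sqrt_const_sub h.edge_le c).1.continuousOn_mul (by fun_prop))
  rw [edgePotential, edgeWeight, h1.2]
  simp only [mul_assoc, intervalIntegral.integral_const_mul]
  have hpi := Real.pi_ne_zero
  field_simp

/-- The Euler–Lagrange equality on the support of the optimal density. -/
theorem edgePotential_of_lt (h : EdgeRelation A p c) {a : ℝ} (ha : p < a) :
    edgePotential A p c a = A / 2 * max (c - a) 0 := by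
  have hz : ∀ s t : ℝ, s ≤ t → t ≤ a → ∀ g : ℝ → ℝ, ∫ u in s..t, √(u - a) * g u = 0 := by
    intro s t hst hta g
    rw [intervalIntegral.integral_congr (g := fun _ => (0 : ℝ)) fun u hu => ?_]
    · simp
    · rw [uIcc_of_le hst] at hu
      simp [Real.sqrt_eq_zero_of_nonpos (by linarith [hu.2] : u - a ≤ 0)]
  have h0 : ∫ u in 0..p, √(u - a) = 0 := by
    simpa using hz 0 p h.edge_nonneg ha.le fun _ => 1
  rw [edgePotential_eq h, h0]
  have hpi := Real.pi_ne_zero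
  rcases le_total c a with hca | hac
  · rw [hz p c h.edge_le hca, max_eq_right (by linarith)]
    simp
  · have hi : IntervalIntegrable (fun u => √(u - a) * (√(c - u))⁻¹) volume p a :=
      (integral_inv_sqrt_const_sub ha.le c).1.continuousOn_mul (by fun_prop)
    obtain ⟨h1, h2⟩ := integral_sqrt_mul_inv_sqrt hac
    rw [← intervalIntegral.integral_add_adjacent_intervals hi h1, hz p a ha.le le_rfl, h2,
      max_eq_left (by linarith)]
    field_simp
    ring

/-- The Euler–Lagrange inequality off the support of the optimal density. -/
theorem edgePotential_le (h : EdgeRelation A p c) (a : ℝ) :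
    edgePotential A p c a ≤ A / 2 * max (c - a) 0 := by
  rcases lt_or_ge p a with ha | ha
  · exact (edgePotential_of_lt h ha).le
  have h0 : 0 ≤ ∫ u in 0..p, √(u - a) :=
    intervalIntegral.integral_nonneg h.edge_nonneg fun u _ => Real.sqrt_nonneg _
  obtain ⟨h1, h2⟩ := integral_sqrt_mul_inv_sqrt (ha.trans h.edge_le)
  have h3 : ∫ u in p..c, √(u - a) * (√(c - u))⁻¹ ≤ Real.pi / 2 * (c - a) := by
    rw [← h2]
    exact intervalIntegral.integral_mono_interval ha h.edge_le le_rfl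
      (Eventually.of_forall fun u => by simp only [Pi.zero_apply]; positivity) h1
  have hA := h.slope_nonneg
  rw [edgePotential_eq h, max_eq_left (by linarith [h.edge_le])]
  have h4 : A / Real.pi * ∫ u in p..c, √(u - a) * (√(c - u))⁻¹ ≤
      A / Real.pi * (Real.pi / 2 * (c - a)) := by gcongr
  have h5 : A / Real.pi * (Real.pi / 2 * (c - a)) = A / 2 * (c - a) := by
    have hpi := Real.pi_ne_zero
    field_simp
  linarith

/-! ### Expansion of the energy and the minimal cost -/

theorem LogMoment.sub {f g : ℝ → ℝ} (hf : LogMoment f) (hg : LogMoment g) :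
    LogMoment fun x => f x - g x :=
  ⟨hf.integrable.sub hg.integrable, (hf.log.sub hg.log).congr (Eventually.of_forall fun x => by
    simp only [Pi.sub_apply]; ring)⟩

theorem LogMoment.congr {f g : ℝ → ℝ} (hf : LogMoment f) (h : f =ᵐ[volume] g) : LogMoment g :=
  ⟨hf.integrable.congr h, hf.log.congr (by filter_upwards [h] with x hx; rw [hx])⟩

theorem Admissible.logMoment {μ : ℝ → ℝ} (hμ : Admissible μ) : LogMoment (charge μ) :=
  LogMoment.of_integrable_energy hμ.integrable_charge hμ.integrable_energy

theorem measurable_airyDensity : Measurable airyDensity := by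
  rw [show airyDensity = fun a => √a / Real.pi from funext airyDensity_eq]
  fun_prop

theorem Admissible.aestronglyMeasurable {μ : ℝ → ℝ} (hμ : Admissible μ) :
    AEStronglyMeasurable μ :=
  (hμ.integrable_charge.aestronglyMeasurable.add
    measurable_airyDensity.aestronglyMeasurable).congr (Eventually.of_forall fun x => by
      simp [charge])

theorem EdgeRelation.charge_ae_eq (h : EdgeRelation A p c) :
    abel (edgeWeight A p c) =ᵐ[volume] charge (edgeDensity A p c) := by
  filter_upwards [ae_ne c] with a ha using (charge_edgeDensity h ha).symm

theorem EdgeRelation.logMoment (h : EdgeRelation A p c) :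
    LogMoment (charge (edgeDensity A p c)) :=
  h.neutralWeight.logMoment_abel.congr h.charge_ae_eq

theorem EdgeRelation.sq_integrable (h : EdgeRelation A p c) :
    Integrable fun x => charge (edgeDensity A p c) x ^ 2 :=
  h.neutralWeight.integrable_abel_sq.congr (by
    filter_upwards [h.charge_ae_eq] with x hx; rw [hx])

theorem EdgeRelation.integral_log_mul_charge (h : EdgeRelation A p c) (a : ℝ) :
    ∫ b, Real.log |a - b| * charge (edgeDensity A p c) b = edgePotential A p c a := by
  rw [edgePotential, ← h.neutralWeight.integral_log_mul_abel]
  refine integral_congr_ae ?_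
  filter_upwards [h.charge_ae_eq] with x hx
  rw [hx]

theorem EdgeRelation.admissible (h : EdgeRelation A p c) : Admissible (edgeDensity A p c) where
  nonneg := Eventually.of_forall (edgeDensity_nonneg h.slope_nonneg)
  integrable_charge := h.logMoment.integrable
  mass_balance := by
    rw [← h.neutralWeight.integral_abel]
    exact (integral_congr_ae h.charge_ae_eq).symm
  integrable_energy := h.logMoment.integrable_log_mul h.logMoment h.sq_integrable

/-- The mutual energy of a charge with the optimal charge is read off from the potential. -/
theorem EdgeRelation.integral_mutual (h : EdgeRelation A p c) {f : ℝ → ℝ} (hf : LogMoment f) :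
    Integrable (fun a => f a * edgePotential A p c a) ∧
      ∫ q : ℝ × ℝ, Real.log |q.1 - q.2| * (f q.1 * charge (edgeDensity A p c) q.2) =
        ∫ a, f a * edgePotential A p c a := by
  have hi := hf.integrable_log_mul h.logMoment h.sq_integrable
  have e : ∀ a, ∫ b, Real.log |a - b| * (f a * charge (edgeDensity A p c) b) =
      f a * edgePotential A p c a := fun a => by
    rw [← h.integral_log_mul_charge, ← integral_const_mul]
    congr 1; funext b; ring
  constructor
  · exact hi.integral_prod_left.congr (Eventually.of_forall e)
  · rw [Measure.volume_eq_prod, integral_prod _ hi]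
    exact integral_congr_ae (Eventually.of_forall e)

theorem integral_sub_sub_sub {f g h k : ℝ × ℝ → ℝ} (hf : Integrable f) (hg : Integrable g)
    (hh : Integrable h) (hk : Integrable k) :
    ∫ q, (f q - g q - h q - k q) = (∫ q, f q) - (∫ q, g q) - (∫ q, h q) - ∫ q, k q := by
  have e := integral_sub' ((hf.sub hg).sub hh) hk
  rwa [integral_sub' (hf.sub hg) hh, integral_sub' hf hg] at e

/-- The energy of a candidate density, expanded around the optimal one: a quadratic term, which is
positive definite, and a linear term given by the potential. -/
theorem EdgeRelation.airyJ_expand (h : EdgeRelation A p c) {μ : ℝ → ℝ} (hμ : Admissible μ) :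
    Integrable (fun a => (μ a - edgeDensity A p c a) * edgePotential A p c a) ∧
    ∃ E : ℝ, 0 ≤ E ∧ (E = 0 → μ =ᵐ[volume] edgeDensity A p c) ∧
      airyJ μ = airyJ (edgeDensity A p c) + E -
        2 * ∫ a, (μ a - edgeDensity A p c a) * edgePotential A p c a := by
  set r := charge (edgeDensity A p c) with hr
  set ν : ℝ → ℝ := fun a => μ a - edgeDensity A p c a with hν
  have hνe : (fun x => charge μ x - r x) = ν := by
    funext x; simp [hr, hν, charge]
  have hνm : LogMoment ν := hνe ▸ hμ.logMoment.sub h.logMoment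
  have hν0 : ∫ x, ν x = 0 := by
    rw [← hνe, integral_sub hμ.integrable_charge h.logMoment.integrable, hμ.mass_balance,
      h.admissible.mass_balance, sub_zero]
  obtain ⟨i0, e0⟩ := h.integral_mutual hνm
  have i1 : Integrable fun q : ℝ × ℝ => Real.log |q.1 - q.2| * (ν q.1 * r q.2) :=
    hνm.integrable_log_mul h.logMoment h.sq_integrable
  have esw : (fun q : ℝ × ℝ => Real.log |q.1 - q.2| * (r q.1 * ν q.2)) =
      (fun q : ℝ × ℝ => Real.log |q.1 - q.2| * (ν q.1 * r q.2)) ∘ Prod.swap := by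
    funext q
    simp only [Function.comp, Prod.fst_swap, Prod.snd_swap, abs_sub_comm q.2]
    ring
  have i2 : Integrable fun q : ℝ × ℝ => Real.log |q.1 - q.2| * (r q.1 * ν q.2) := by
    rw [esw]; exact i1.swap
  have e2 : ∫ q : ℝ × ℝ, Real.log |q.1 - q.2| * (r q.1 * ν q.2) =
      ∫ q : ℝ × ℝ, Real.log |q.1 - q.2| * (ν q.1 * r q.2) := by
    rw [esw]
    exact integral_prod_swap (μ := volume) (ν := volume)
      fun q : ℝ × ℝ => Real.log |q.1 - q.2| * (ν q.1 * r q.2)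
  have i3 : Integrable fun q : ℝ × ℝ => Real.log |q.1 - q.2| * (r q.1 * r q.2) :=
    h.admissible.integrable_energy
  have eν : (fun q : ℝ × ℝ => Real.log |q.1 - q.2| * (ν q.1 * ν q.2)) = fun q =>
      energyIntegrand μ q - Real.log |q.1 - q.2| * (r q.1 * r q.2) -
        Real.log |q.1 - q.2| * (ν q.1 * r q.2) - Real.log |q.1 - q.2| * (r q.1 * ν q.2) := by
    funext q
    rw [energyIntegrand, ← hνe]
    ring
  have i4 : Integrable fun q : ℝ × ℝ => Real.log |q.1 - q.2| * (ν q.1 * ν q.2) := by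
    rw [eν]; exact ((hμ.integrable_energy.sub i3).sub i1).sub i2
  refine ⟨i0, -∫ q : ℝ × ℝ, Real.log |q.1 - q.2| * (ν q.1 * ν q.2),
    neg_integral_log_nonneg hνm.integrable hν0 i4, fun hE => ?_, ?_⟩
  · filter_upwards [ae_eq_zero_of_integral_log hνm.integrable hν0 i4 hE] with x hx
    exact sub_eq_zero.1 hx
  · rw [eν, integral_sub_sub_sub hμ.integrable_energy i3 i1 i2, e2, e0, airyJ, airyJ]
    simp only [energyIntegrand, ← hr]
    ring

/-- The linear cost of a density as a real number. -/
theorem wall_eq_ofReal {μ : ℝ → ℝ} (hμ : ∀ᵐ a, 0 ≤ μ a) (hm : AEStronglyMeasurable μ)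
    (hw : wall c μ ≠ ⊤) :
    Integrable (fun a => max (c - a) 0 * μ a) ∧
      wall c μ = ENNReal.ofReal (∫ a, max (c - a) 0 * μ a) := by
  have h0 : ∀ᵐ a, 0 ≤ max (c - a) 0 * μ a := by
    filter_upwards [hμ] with a ha using mul_nonneg (le_max_right _ _) ha
  have hm' : AEStronglyMeasurable (fun a => max (c - a) 0 * μ a) volume :=
    (Measurable.aestronglyMeasurable (by fun_prop)).mul hm
  have hi : Integrable (fun a => max (c - a) 0 * μ a) :=
    ⟨hm', (hasFiniteIntegral_iff_ofReal h0).2 (lt_top_iff_ne_top.2 hw)⟩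
  exact ⟨hi, (ofReal_integral_eq_lintegral_ofReal hi h0).symm⟩

theorem EdgeRelation.setIntegral_sub_mul_edgeDensity (h : EdgeRelation A p c) :
    IntegrableOn (fun a => (c - a) * edgeDensity A p c a) (Ioc 0 c) ∧
      ∫ a in Ioc 0 c, (c - a) * edgeDensity A p c a =
        4 / (15 * Real.pi) * √(c - p) ^ 5 + A / (3 * Real.pi ^ 2) * √(c - p) ^ 4 := by
  have hp := h.edge_nonneg
  have hpc := h.edge_le
  have hc : 0 ≤ c := hp.trans hpc
  have hφ : IntegrableOn (fun a : ℝ => (c - a) ^ 2) (Ioc 0 c) :=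
    (by fun_prop : Continuous fun a : ℝ => (c - a) ^ 2).integrableOn_Icc.mono_set
      Ioc_subset_Icc_self
  have i1 := h.neutralWeight.integrableOn_mul_abel (φ := fun a => c - a) (by fun_prop) hφ
  have e1 := h.neutralWeight.setIntegral_mul_abel (φ := fun a => c - a) (by fun_prop) hφ le_rfl
    (I := fun u => 4 / 3 * ((c - u) * √(c - u)))
    (Eventually.of_forall fun u hu _ => integral_sub_mul_inv_sqrt hu.2)
  have i2 : IntegrableOn (fun a : ℝ => (c - a) * √a / Real.pi) (Ioc 0 c) :=
    (by fun_prop : Continuous fun a : ℝ => (c - a) * √a / Real.pi).integrableOn_Icc.mono_set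
      Ioc_subset_Icc_self
  have e : (fun a => (c - a) * √a / Real.pi + (c - a) * abel (edgeWeight A p c) a)
      =ᵐ[volume.restrict (Ioc 0 c)] fun a => (c - a) * edgeDensity A p c a := by
    filter_upwards [ae_restrict_of_ae h.charge_ae_eq] with a ha
    rw [ha, charge, airyDensity_eq]
    ring
  refine ⟨(i2.add i1).congr e, ?_⟩
  have hcu : EqOn (fun u => 4 / 3 * ((c - u) * √(c - u)) * (√(c - u))⁻¹)
      (fun u => 4 / 3 * (c - u)) (uIcc p c) := by
    intro u hu
    rw [uIcc_of_le hpc] at hu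
    rcases hu.2.eq_or_lt with rfl | hlt
    · simp
    · have : √(c - u) ≠ 0 := (Real.sqrt_pos.2 (sub_pos.2 hlt)).ne'
      simp only
      field_simp
  have e3 := (integral_twoPiece_mul (κ := -(1 / (2 * Real.pi))) (l := A / (2 * Real.pi ^ 2)) hp hpc
    (g := fun u => 4 / 3 * ((c - u) * √(c - u)))
    ((by fun_prop : Continuous fun u => 4 / 3 * ((c - u) * √(c - u))).intervalIntegrable _ _)
    ((integral_inv_sqrt_const_sub hpc c).1.continuousOn_mul (by fun_prop))).2
  rw [← integral_congr_ae e, integral_add i2 i1, e1, edgeWeight, e3,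
    intervalIntegral.integral_congr hcu, intervalIntegral.integral_const_mul,
    intervalIntegral.integral_const_mul, integral_sub_mul_sqrt_sub hp hpc,
    integral_div, ← intervalIntegral.integral_of_le hc, integral_sub_mul_sqrt hc]
  have e4 : ∫ u in p..c, (c - u) = √(c - p) ^ 4 / 2 := by
    rw [intervalIntegral.integral_sub (by simp) (by simp), integral_id,
      show √(c - p) ^ 4 = (√(c - p) ^ 2) ^ 2 by ring, Real.sq_sqrt (sub_nonneg.2 hpc)]
    simp
    ring
  rw [e4, sub_zero]
  have hpi := Real.pi_ne_zero
  field_simp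
  ring

theorem EdgeRelation.integral_wall (h : EdgeRelation A p c) :
    Integrable (fun a => max (c - a) 0 * edgeDensity A p c a) ∧
    ∫ a, max (c - a) 0 * edgeDensity A p c a =
        4 / (15 * Real.pi) * √(c - p) ^ 5 + A / (3 * Real.pi ^ 2) * √(c - p) ^ 4 := by
  have e : (fun a => max (c - a) 0 * edgeDensity A p c a) =
      (Ioc 0 c).indicator fun a => (c - a) * edgeDensity A p c a := by
    funext a
    by_cases ha : a ∈ Ioc 0 c
    · rw [indicator_of_mem ha, max_eq_left (sub_nonneg.2 ha.2)]
    · rw [indicator_of_notMem ha]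
      by_cases h0 : a ≤ 0
      · rw [edgeDensity_of_le (h0.trans h.edge_nonneg), mul_zero]
      · have : c < a := by
          by_contra hc; exact ha ⟨not_le.1 h0, not_lt.1 hc⟩
        rw [max_eq_right (by linarith), zero_mul]
  obtain ⟨h1, h2⟩ := h.setIntegral_sub_mul_edgeDensity
  rw [e]
  exact ⟨(integrable_indicator_iff measurableSet_Ioc).2 h1, by
    rw [integral_indicator measurableSet_Ioc, h2]⟩

theorem EdgeRelation.edgePotential_eq_zero (h : EdgeRelation A p c) {a : ℝ} (ha : c ≤ a) :
    edgePotential A p c a = 0 := by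
  rw [edgePotential, integral_eq_zero_of_ae]
  refine Eventually.of_forall fun u => ?_
  by_cases hu : u ∈ Icc 0 c
  · simp [Real.sqrt_eq_zero_of_nonpos (by linarith [hu.2] : u - a ≤ 0)]
  · simp [h.neutralWeight.support u hu]

/-- By Fubini's theorem and the area of a half disc. -/
theorem EdgeRelation.integral_airyDensity_mul_potential (h : EdgeRelation A p c) :
    Integrable (fun a => airyDensity a * edgePotential A p c a) ∧
    ∫ a, airyDensity a * edgePotential A p c a =
      Real.pi / 4 * ∫ u, edgeWeight A p c u * u ^ 2 := by
  have hc : 0 ≤ c := h.edge_nonneg.trans h.edge_le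
  have hw := h.neutralWeight
  have hpi := Real.pi_ne_zero
  have hG : Integrable (Function.uncurry fun a u =>
      (√a / Real.pi) * (edgeWeight A p c u * (2 * Real.pi * √(u - a))))
      ((volume.restrict (Ioc 0 c)).prod volume) := by
    have h1 : Integrable (fun q : ℝ × ℝ => (1 : ℝ) * ‖edgeWeight A p c q.2‖)
        ((volume.restrict (Ioc 0 c)).prod volume) :=
      (integrable_const (1 : ℝ)).mul_prod hw.integrable.norm
    refine (h1.const_mul (2 * √c * √c)).mono' ?_ ?_
    · exact (Measurable.aestronglyMeasurable (by fun_prop)).mul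
        ((hw.integrable.aestronglyMeasurable.comp_snd (μ := volume.restrict (Ioc 0 c))).mul
          (Measurable.aestronglyMeasurable (by fun_prop)))
    · have hae : ∀ᵐ q ∂((volume.restrict (Ioc 0 c)).prod (volume : Measure ℝ)), q.1 ∈ Ioc 0 c :=
        Measure.quasiMeasurePreserving_fst.ae (ae_restrict_mem measurableSet_Ioc)
      filter_upwards [hae] with q hq
      by_cases hu : q.2 ∈ Icc 0 c
      · have h2 : √q.1 ≤ √c := Real.sqrt_le_sqrt hq.2
        have h3 : √(q.2 - q.1) ≤ √c := Real.sqrt_le_sqrt (by linarith [hq.1, hu.2])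
        simp only [Function.uncurry, norm_mul, norm_div, Real.norm_of_nonneg (Real.sqrt_nonneg _),
          Real.norm_of_nonneg Real.pi_pos.le, Real.norm_of_nonneg zero_le_two]
        calc √q.1 / Real.pi * (‖edgeWeight A p c q.2‖ * (2 * Real.pi * √(q.2 - q.1)))
            = 2 * √q.1 * √(q.2 - q.1) * ‖edgeWeight A p c q.2‖ := by field_simp
          _ ≤ 2 * √c * √c * (1 * ‖edgeWeight A p c q.2‖) := by
              rw [one_mul]; gcongr
      · simp [Function.uncurry, hw.support _ hu]
  have e : (fun a => airyDensity a * edgePotential A p c a) = (Ioc 0 c).indicator fun a =>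
      ∫ u, (√a / Real.pi) * (edgeWeight A p c u * (2 * Real.pi * √(u - a))) := by
    funext a
    by_cases ha : a ∈ Ioc 0 c
    · rw [indicator_of_mem ha, integral_const_mul, airyDensity_eq, edgePotential]
    · rw [indicator_of_notMem ha]
      by_cases h0 : a ≤ 0
      · rw [airyDensity_eq, Real.sqrt_eq_zero_of_nonpos h0]; simp
      · have : c ≤ a := by
          by_contra hca; exact ha ⟨not_le.1 h0, (not_le.1 hca).le⟩
        rw [h.edgePotential_eq_zero this, mul_zero]
  rw [e]
  refine ⟨(integrable_indicator_iff measurableSet_Ioc).2 hG.integral_prod_left, ?_⟩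
  rw [integral_indicator measurableSet_Ioc, integral_integral_swap hG, ← integral_const_mul]
  congr 1
  funext u
  by_cases hu : u ∈ Icc 0 c
  · have e1 : ∫ a in Ioc 0 c, √a * √(u - a) = Real.pi / 8 * u ^ 2 := by
      rw [← integral_sqrt_mul_sqrt hu.1, intervalIntegral.integral_of_le hu.1]
      refine setIntegral_eq_of_subset_of_forall_sdiff_eq_zero measurableSet_Ioc
        (Ioc_subset_Ioc_right hu.2) fun a ha => ?_
      have : u ≤ a := by
        by_contra hc; exact ha.2 ⟨ha.1.1, (not_le.1 hc).le⟩
      simp [Real.sqrt_eq_zero_of_nonpos (sub_nonpos.2 this)]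
    have e2 : ∀ a, √a / Real.pi * (edgeWeight A p c u * (2 * Real.pi * √(u - a))) =
        2 * edgeWeight A p c u * (√a * √(u - a)) := fun a => by field_simp
    simp_rw [e2]
    rw [integral_const_mul, e1]
    ring
  · simp [hw.support u hu]

theorem EdgeRelation.integral_edgeWeight_mul_sq (h : EdgeRelation A p c) :
    ∫ u, edgeWeight A p c u * u ^ 2 = -(1 / (2 * Real.pi)) * (p ^ 3 / 3) +
      A / (2 * Real.pi ^ 2) *
        (2 * (c ^ 2 * √(c - p) - 2 / 3 * c * √(c - p) ^ 3 + √(c - p) ^ 5 / 5)) := by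
  obtain ⟨h1, h2⟩ := integral_sq_mul_inv_sqrt h.edge_le
  rw [edgeWeight, (integral_twoPiece_mul h.edge_nonneg h.edge_le
    ((by fun_prop : Continuous fun u : ℝ => u ^ 2).intervalIntegrable _ _) h1).2, h2, integral_pow]
  norm_num

/-- The energy of the optimal density, from the Euler–Lagrange equality on its support. -/
theorem EdgeRelation.airyJ_edgeDensity (h : EdgeRelation A p c) :
    airyJ (edgeDensity A p c) =
      -(A / 2) * (∫ a, max (c - a) 0 * edgeDensity A p c a) +
        Real.pi / 4 * ∫ u, edgeWeight A p c u * u ^ 2 := by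
  have h1 := (h.integral_mutual h.logMoment).2
  obtain ⟨i2, h2⟩ := h.integral_airyDensity_mul_potential
  have e : (fun a => charge (edgeDensity A p c) a * edgePotential A p c a) = fun a =>
      A / 2 * (max (c - a) 0 * edgeDensity A p c a) - airyDensity a * edgePotential A p c a := by
    funext a
    rw [charge, sub_mul]
    congr 1
    rcases le_or_gt a p with ha | ha
    · rw [edgeDensity_of_le ha]; ring
    · rw [edgePotential_of_lt h ha]; ring
  rw [e, integral_sub (h.integral_wall.1.const_mul _) i2, integral_const_mul, h2] at h1
  rw [airyJ]
  simp only [energyIntegrand]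
  rw [h1]
  ring

/-- The minimal cost in terms of the left edge `p` and the distance `c - p` to the wall. -/
theorem EdgeRelation.cost_edgeDensity (h : EdgeRelation A p c) :
    A * (∫ a, max (c - a) 0 * edgeDensity A p c a) + airyJ (edgeDensity A p c) =
      p ^ 3 / 12 + 5 / 24 * p ^ 2 * (c - p) + 2 / 15 * p * (c - p) ^ 2 := by
  rw [h.airyJ_edgeDensity, h.integral_wall.2, h.integral_edgeWeight_mul_sq]
  have hpi := Real.pi_ne_zero
  have hn := h.neutral
  have hs := Real.sq_sqrt (sub_nonneg.2 h.edge_le)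
  generalize √(c - p) = r at hn hs ⊢
  have hc : c = p + r ^ 2 := by linarith
  subst hc
  -- by neutrality the edge is `p = 2 A r / π` with `r = √(c - p)`
  have hp : p = 2 * A * r / Real.pi := by field_simp; linarith
  rw [hp]
  field_simp
  ring

/-! ### Minimality, parametrisation of the edge, and scaling -/

theorem EdgeRelation.wall_edgeDensity (h : EdgeRelation A p c) :
    (A : EReal) * (wall c (edgeDensity A p c) : EReal) =
      ((A * ∫ a, max (c - a) 0 * edgeDensity A p c a : ℝ) : EReal) := by
  have h0 : ∀ a, 0 ≤ max (c - a) 0 * edgeDensity A p c a := fun a =>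
    mul_nonneg (le_max_right _ _) (edgeDensity_nonneg h.slope_nonneg a)
  rw [wall, ← ofReal_integral_eq_lintegral_ofReal h.integral_wall.1 (Eventually.of_forall h0),
    EReal.coe_ennreal_ofReal, max_eq_left (integral_nonneg h0), EReal.coe_mul]

theorem EdgeRelation.sigmaJ_edgeDensity (h : EdgeRelation A p c) :
    sigmaJ A c (edgeDensity A p c) =
      ((p ^ 3 / 12 + 5 / 24 * p ^ 2 * (c - p) + 2 / 15 * p * (c - p) ^ 2 : ℝ) : EReal) := by
  rw [sigmaJ, h.wall_edgeDensity, ← EReal.coe_add, h.cost_edgeDensity]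

/-- The Euler–Lagrange relations bound the linear term of the expansion of the energy by the
difference of the linear costs. For `A = 0` the linear cost of a candidate may be infinite, but it
does not enter. -/
theorem EdgeRelation.linear_term_le (h : EdgeRelation A p c) {μ : ℝ → ℝ} (hμ : Admissible μ)
    (hw : (A : EReal) * (wall c μ : EReal) ≠ ⊤) :
    ∃ W : ℝ, (A : EReal) * (wall c μ : EReal) = (W : EReal) ∧
      2 * ∫ a, (μ a - edgeDensity A p c a) * edgePotential A p c a ≤
        W - A * ∫ a, max (c - a) 0 * edgeDensity A p c a := by
  have hpt : ∀ᵐ a, (μ a - edgeDensity A p c a) * edgePotential A p c a ≤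
      A / 2 * (max (c - a) 0 * μ a - max (c - a) 0 * edgeDensity A p c a) := by
    filter_upwards [hμ.nonneg] with a ha
    rcases le_or_gt a p with hap | hap
    -- off the support only the inequality holds, but there the difference is `μ a ≥ 0`
    · rw [edgeDensity_of_le hap]
      nlinarith [mul_le_mul_of_nonneg_left (edgePotential_le h a) ha]
    · rw [edgePotential_of_lt h hap]
      exact le_of_eq (by ring)
  have hi := (h.airyJ_expand hμ).1
  rcases h.slope_nonneg.eq_or_lt with hA | hA
  · refine ⟨0, by simp [← hA], ?_⟩
    have : ∫ a, (μ a - edgeDensity A p c a) * edgePotential A p c a ≤ 0 :=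
      integral_nonpos_of_ae (by
        filter_upwards [hpt] with a ha
        rw [← hA, zero_div, zero_mul] at ha
        simpa [← hA] using ha)
    rw [← hA] at this ⊢
    linarith
  · have hw' : wall c μ ≠ ⊤ := by
      intro ht
      rw [ht, EReal.coe_ennreal_top, EReal.coe_mul_top_of_pos hA] at hw
      exact hw rfl
    obtain ⟨i1, e1⟩ := wall_eq_ofReal hμ.nonneg hμ.aestronglyMeasurable hw'
    have h0 : 0 ≤ ∫ a, max (c - a) 0 * μ a := integral_nonneg_of_ae (by
      filter_upwards [hμ.nonneg] with a ha using mul_nonneg (le_max_right _ _) ha)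
    refine ⟨A * ∫ a, max (c - a) 0 * μ a, ?_, ?_⟩
    · rw [e1, EReal.coe_ennreal_ofReal, max_eq_left h0, EReal.coe_mul]
    · have h2 := integral_mono_ae hi ((i1.sub h.integral_wall.1).const_mul (A / 2)) hpt
      rw [integral_const_mul, integral_sub' i1 h.integral_wall.1] at h2
      linarith

/-- Minimality, with the equality case phrased as an inequality so that it also serves for costs
above `sigmaJ`. -/
theorem EdgeRelation.sigmaJ_le (h : EdgeRelation A p c) {μ : ℝ → ℝ} (hμ : Admissible μ) :
    sigmaJ A c (edgeDensity A p c) ≤ sigmaJ A c μ ∧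
      (sigmaJ A c μ ≤ sigmaJ A c (edgeDensity A p c) → μ =ᵐ[volume] edgeDensity A p c) := by
  have hv : sigmaJ A c (edgeDensity A p c) =
      ((A * (∫ a, max (c - a) 0 * edgeDensity A p c a) + airyJ (edgeDensity A p c) : ℝ) : EReal) := by
    rw [sigmaJ, h.wall_edgeDensity, ← EReal.coe_add]
  by_cases hw : (A : EReal) * (wall c μ : EReal) = ⊤
  · have ht : sigmaJ A c μ = ⊤ := by rw [sigmaJ, hw, EReal.top_add_coe]
    rw [ht, hv]
    exact ⟨le_top, fun hle => absurd (top_le_iff.1 hle) (EReal.coe_ne_top _)⟩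
  · obtain ⟨W, hW, hle⟩ := h.linear_term_le hμ hw
    obtain ⟨-, E, hE0, hE, hJ⟩ := h.airyJ_expand hμ
    have hs : sigmaJ A c μ = ((W + airyJ μ : ℝ) : EReal) := by
      rw [sigmaJ, hW, ← EReal.coe_add]
    rw [hs, hv, EReal.coe_le_coe_iff, EReal.coe_le_coe_iff]
    exact ⟨by linarith, fun h1 => hE (le_antisymm (by linarith) hE0)⟩

theorem EdgeRelation.isUniqueMinimizer_sigmaJ (h : EdgeRelation A p c) :
    IsUniqueMinimizer (sigmaJ A c) (edgeDensity A p c) :=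
  ⟨h.admissible, fun _ hμ => (h.sigmaJ_le hμ).1, fun _ hμ he => (h.sigmaJ_le hμ).2 he.le⟩

theorem sigma_eq (A c : ℝ) (μ : ℝ → ℝ) : sigma A c μ = sigmaJ A c μ + (airyU μ : EReal) := by
  rw [sigma, sigmaJ, airyI, add_assoc]

theorem sigmaJ_le_sigma (A c : ℝ) (μ : ℝ → ℝ) : sigmaJ A c μ ≤ sigma A c μ := by
  rw [sigma_eq]
  exact le_add_of_nonneg_right (EReal.coe_ennreal_nonneg _)

theorem airyU_edgeDensity (hp : 0 ≤ p) : airyU (edgeDensity A p c) = 0 := by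
  rw [airyU, setLIntegral_congr_fun (g := fun _ => 0) measurableSet_Iio fun a ha => ?_]
  · simp
  · have ha' : a < 0 := ha
    simp [edgeDensity_of_le (c := c) (A := A) (ha'.le.trans hp)]

theorem sigma_edgeDensity (hp : 0 ≤ p) :
    sigma A c (edgeDensity A p c) = sigmaJ A c (edgeDensity A p c) := by
  rw [sigma_eq, airyU_edgeDensity hp]
  simp

theorem EdgeRelation.isUniqueMinimizer_sigma (h : EdgeRelation A p c) :
    IsUniqueMinimizer (sigma A c) (edgeDensity A p c) := by
  have e := sigma_edgeDensity (A := A) (c := c) h.edge_nonneg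
  refine ⟨h.admissible, fun μ hμ => ?_, fun μ hμ he => ?_⟩
  · rw [e]
    exact (h.sigmaJ_le hμ).1.trans (sigmaJ_le_sigma A c μ)
  · rw [e] at he
    exact (h.sigmaJ_le hμ).2 ((sigmaJ_le_sigma A c μ).trans he.le)

theorem leftEdge_zero (a₀ : ℝ) : leftEdge 0 a₀ = 0 := by simp [leftEdge]

/-- The left edge and the wall in terms of `s = √(1 + π² a₀ / A²)`. -/
theorem leftEdge_param {A a₀ : ℝ} (hA : 0 < A) (ha : 0 ≤ a₀) :
    ∃ s : ℝ, 1 ≤ s ∧ (0 < a₀ → 1 < s) ∧ s ^ 2 = 1 + Real.pi ^ 2 * a₀ / A ^ 2 ∧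
      leftEdge A a₀ = 2 * A ^ 2 / Real.pi ^ 2 * (s - 1) ∧
      a₀ = A ^ 2 / Real.pi ^ 2 * (s ^ 2 - 1) := by
  have h0 : 0 ≤ Real.pi ^ 2 * a₀ / A ^ 2 := by positivity
  have hsq := Real.sq_sqrt (by linarith : 0 ≤ 1 + Real.pi ^ 2 * a₀ / A ^ 2)
  refine ⟨√(1 + Real.pi ^ 2 * a₀ / A ^ 2), Real.one_le_sqrt.2 (by linarith), fun h => ?_, hsq,
    rfl, ?_⟩
  · have : 0 < Real.pi ^ 2 * a₀ / A ^ 2 := by positivity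
    exact Real.lt_sqrt_of_sq_lt (by linarith)
  · rw [hsq]
    have := Real.pi_ne_zero
    field_simp
    ring

theorem edgeRelation_leftEdge {A a₀ : ℝ} (hA : 0 ≤ A) (ha : 0 ≤ a₀) :
    EdgeRelation A (leftEdge A a₀) a₀ := by
  rcases hA.eq_or_lt with rfl | hA'
  · rw [leftEdge_zero]
    exact ⟨le_rfl, le_rfl, ha, by simp⟩
  obtain ⟨s, hs, -, -, hl, ha0⟩ := leftEdge_param hA' ha
  have hs' : 0 ≤ s - 1 := sub_nonneg.2 hs
  have hd : a₀ - leftEdge A a₀ = (A / Real.pi * (s - 1)) ^ 2 := by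
    rw [hl]; nth_rw 1 [ha0]; ring
  refine ⟨hA, by rw [hl]; positivity, ?_, ?_⟩
  · rw [← sub_nonneg, hd]; positivity
  · rw [hd, Real.sqrt_sq (by positivity), hl]
    have := Real.pi_ne_zero
    field_simp

theorem cost_leftEdge {A a₀ : ℝ} (hA : 0 ≤ A) (ha : 0 ≤ a₀) :
    leftEdge A a₀ ^ 3 / 12 + 5 / 24 * leftEdge A a₀ ^ 2 * (a₀ - leftEdge A a₀) +
      2 / 15 * leftEdge A a₀ * (a₀ - leftEdge A a₀) ^ 2 = A ^ 6 * phiMinus (-a₀ / A ^ 2) := by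
  rcases hA.eq_or_lt with rfl | hA'
  -- for `A = 0` both sides vanish: the left edge is `0`, and so is the factor `A ^ 6`
  · simp [leftEdge_zero]
  obtain ⟨s, hs, -, hsq, hl, ha0⟩ := leftEdge_param hA' ha
  have hpow : (1 - Real.pi ^ 2 * (-a₀ / A ^ 2)) ^ (5 / 2 : ℝ) = s ^ 5 := by
    rw [show 1 - Real.pi ^ 2 * (-a₀ / A ^ 2) = s ^ 2 by rw [hsq]; ring,
      ← Real.rpow_natCast s 2, ← Real.rpow_mul (by linarith), ← Real.rpow_natCast]
    norm_num
  rw [phiMinus, hpow, hl]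
  have := Real.pi_ne_zero
  rw [ha0]
  field_simp
  ring

theorem leftEdge_pos_lt {A a₀ : ℝ} (hA : 0 < A) (ha : 0 < a₀) :
    0 < leftEdge A a₀ ∧ leftEdge A a₀ < a₀ := by
  obtain ⟨s, -, hs, -, hl, ha0⟩ := leftEdge_param hA ha.le
  have hs' : 0 < s - 1 := sub_pos.2 (hs ha)
  have := Real.pi_pos
  refine ⟨by rw [hl]; positivity, ?_⟩
  rw [← sub_pos]
  have hd : a₀ - leftEdge A a₀ = (A / Real.pi * (s - 1)) ^ 2 := by
    rw [hl]; nth_rw 1 [ha0]; ring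
  rw [hd]
  positivity

/-- Near the wall the density is `-(A / (2π²)) log |a - c|` plus a continuous function. -/
theorem tendsto_edgeDensity_div_log (hpc : p < c) :
    Tendsto (fun a => edgeDensity A p c a / Real.log (1 / |a - c|)) (𝓝[≠] c)
      (𝓝 (A / (2 * Real.pi ^ 2))) := by
  have hl : Tendsto (fun a => Real.log (1 / |a - c|)) (𝓝[≠] c) atTop := by
    have h1 : Tendsto (fun a => |a - c|) (𝓝[≠] c) (𝓝[>] 0) := by
      refine tendsto_nhdsWithin_iff.2 ⟨?_, ?_⟩
      · have : Continuous fun a => |a - c| := by fun_prop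
        simpa using (this.tendsto c).mono_left nhdsWithin_le_nhds
      · filter_upwards [self_mem_nhdsWithin] with a ha
        exact abs_pos.2 (sub_ne_zero.2 ha)
    have h2 := (Real.tendsto_log_nhdsGT_zero).comp h1
    refine (tendsto_neg_atBot_atTop.comp h2).congr fun a => ?_
    simp [Function.comp, Real.log_inv]
  set g : ℝ → ℝ := fun a => 1 / Real.pi * √(a - p) +
    A / (2 * Real.pi ^ 2) * (2 * Real.log (√(a - p) + √(c - p))) with hg
  have hgc : ContinuousAt g c := by
    have hpos : √(c - p) + √(c - p) ≠ 0 := by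
      have : 0 < √(c - p) := Real.sqrt_pos.2 (sub_pos.2 hpc)
      positivity
    have h1 : ContinuousAt (fun a => Real.log (√(a - p) + √(c - p))) c :=
      ContinuousAt.log (by fun_prop) hpos
    exact ContinuousAt.add (by fun_prop) (continuousAt_const.mul (continuousAt_const.mul h1))
  have h3 : Tendsto (fun a => g a / Real.log (1 / |a - c|) + A / (2 * Real.pi ^ 2)) (𝓝[≠] c)
      (𝓝 (A / (2 * Real.pi ^ 2))) := by
    simpa using ((hgc.tendsto.mono_left nhdsWithin_le_nhds).div_atTop hl).add_const
      (A / (2 * Real.pi ^ 2))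
  refine h3.congr' ?_
  filter_upwards [self_mem_nhdsWithin, mem_nhdsWithin_of_mem_nhds (Ioi_mem_nhds hpc),
    hl.eventually_gt_atTop 0] with a hac hpa hpos
  have hac' : a ≠ c := hac
  have e : edgeDensity A p c a =
      g a + A / (2 * Real.pi ^ 2) * Real.log (1 / |a - c|) := by
    have hpa' : p < a := hpa
    rw [edgeDensity, if_pos hpa', ← logProfile_eq hpc.le hpa' hac', logProfile,
      (integral_inv_sqrt_mul_inv_sqrt hpc.le hpa' hac').2, one_div |a - c|, Real.log_inv,
      Real.log_abs, hg]
    ring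
  rw [e, eq_comm, add_div, mul_div_cancel_right₀ _ hpos.ne']

/-- A positive factor in front of the energy is absorbed into the slope of the linear cost. -/
theorem scaled_cost_eq {A B : ℝ} (hB : 0 < B) (c : ℝ) (μ : ℝ → ℝ) :
    (A : EReal) * (wall c μ : EReal) + (B : EReal) * airyI μ = (B : EReal) * sigma (A / B) c μ := by
  rw [sigma, EReal.left_distrib_of_nonneg_of_ne_top (EReal.coe_nonneg.2 hB.le)
    (EReal.coe_ne_top _), ← mul_assoc, ← EReal.coe_mul, mul_div_cancel₀ _ hB.ne']

end AiryGas

theorem mainTheorem2 :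
    (∀ A a₀ : ℝ, 0 ≤ A → 0 ≤ a₀ →
      -- the explicit density is carried by the half line to the right of its left edge
      (∀ a, a ≤ AiryGas.leftEdge A a₀ → AiryGas.optimalDensity A a₀ a = 0) ∧
      (∀ a, AiryGas.leftEdge A a₀ < a → 0 < AiryGas.optimalDensity A a₀ a) ∧
      -- it is the unique minimizer of the reduced cost, with the closed-form minimum
      AiryGas.IsUniqueMinimizer (AiryGas.sigmaJ A a₀) (AiryGas.optimalDensity A a₀) ∧
      AiryGas.sigmaJ A a₀ (AiryGas.optimalDensity A a₀) =
        ((A ^ 6 * AiryGas.phiMinus (-a₀ / A ^ 2) : ℝ) : EReal) ∧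
      -- the same holds for the full cost
      AiryGas.airyU (AiryGas.optimalDensity A a₀) = 0 ∧
      AiryGas.IsUniqueMinimizer (AiryGas.sigma A a₀) (AiryGas.optimalDensity A a₀) ∧
      AiryGas.sigma A a₀ (AiryGas.optimalDensity A a₀) =
        ((A ^ 6 * AiryGas.phiMinus (-a₀ / A ^ 2) : ℝ) : EReal) ∧
      -- position of the left edge, and the logarithmic singularity
      (0 < A → 0 < a₀ →
        0 < AiryGas.leftEdge A a₀ ∧ AiryGas.leftEdge A a₀ < a₀ ∧
        Tendsto (fun a => AiryGas.optimalDensity A a₀ a / Real.log (1 / |a - a₀|))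
          (𝓝[≠] a₀) (𝓝 (A / (2 * Real.pi ^ 2))))) ∧
    -- scaling of the minimum in both constants
    (∀ A B z : ℝ, 0 < A → 0 < B → z ≤ 0 →
      IsLeast
        ((fun μ : ℝ → ℝ =>
            (A : EReal) * (AiryGas.wall (-z) μ : EReal) + (B : EReal) * AiryGas.airyI μ) ''
          {μ | AiryGas.Admissible μ})
        ((A ^ 6 / B ^ 5 * AiryGas.phiMinus (z * B ^ 2 / A ^ 2) : ℝ) : EReal)) := by
  refine ⟨fun A a₀ hA ha => ?_, fun A B z hA hB hz => ?_⟩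
  · have h := AiryGas.edgeRelation_leftEdge hA ha
    have hJ : AiryGas.sigmaJ A a₀ (AiryGas.optimalDensity A a₀) =
        ((A ^ 6 * AiryGas.phiMinus (-a₀ / A ^ 2) : ℝ) : EReal) := by
      rw [← AiryGas.cost_leftEdge hA ha]
      exact h.sigmaJ_edgeDensity
    refine ⟨fun a => AiryGas.edgeDensity_of_le, fun a => AiryGas.edgeDensity_pos hA,
      h.isUniqueMinimizer_sigmaJ, hJ, AiryGas.airyU_edgeDensity h.edge_nonneg,
      h.isUniqueMinimizer_sigma, (AiryGas.sigma_edgeDensity h.edge_nonneg).trans hJ,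
      fun hA' ha' => ?_⟩
    obtain ⟨h1, h2⟩ := AiryGas.leftEdge_pos_lt hA' ha'
    exact ⟨h1, h2, AiryGas.tendsto_edgeDensity_div_log h2⟩
  · have hAB : 0 ≤ A / B := by positivity
    have h := AiryGas.edgeRelation_leftEdge hAB (neg_nonneg.2 hz)
    have hmin := h.isUniqueMinimizer_sigma
    have hval : (B : EReal) * AiryGas.sigma (A / B) (-z)
        (AiryGas.edgeDensity (A / B) (AiryGas.leftEdge (A / B) (-z)) (-z)) =
        ((A ^ 6 / B ^ 5 * AiryGas.phiMinus (z * B ^ 2 / A ^ 2) : ℝ) : EReal) := by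
      rw [AiryGas.sigma_edgeDensity h.edge_nonneg, h.sigmaJ_edgeDensity,
        AiryGas.cost_leftEdge hAB (neg_nonneg.2 hz), ← EReal.coe_mul,
        show - -z / (A / B) ^ 2 = z * B ^ 2 / A ^ 2 by field_simp]
      congr 1
      field_simp
    simp only [AiryGas.scaled_cost_eq hB]
    rw [← hval]
    refine ⟨⟨_, h.admissible, rfl⟩, ?_⟩
    rintro _ ⟨μ, hμ, rfl⟩
    exact mul_le_mul_of_nonneg_left (hmin.le μ hμ) (EReal.coe_nonneg.2 hB.le)
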